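/- All graphs are finite and simple. A graph is $k$-connected if it has at least $k+1$ vertices and remains connected after the deletion of any set of fewer than $k$ vertices. A $d$-dimensional framework $(G,p)$ consists of a graph $G=(V,E)$ and a map $p:V\to\mathbb{R}^d$. It is generic if its $d|V|$ vertex coordinates are algebraically independent over $\mathbb{Q}$. It is rigid if there is an $\varepsilon>0$ such that every $q:V\to\mathbb{R}^d$ with $\|p(v)-q(v)\|<\varepsilon$ for all $v\in V$ and $\|p(u)-p(v)\|=\|q(u)-q(v)\|$ for all $uv\in E$ satisfies $\|p(u)-p(v)\|=\|q(u)-q(v)\|$ for all $u,v\in V$. The graph $G$ is rigid in $\mathbb{R}^d$ if every generic $d$-dimensional framework of $G$ is rigid. The rigidity matrix $R(G,p)$ has one row for each edge and $d$ columns for each vertex; the row of $uv\in E$ has $p(u)-p(v)$ in the columns of $u$, $p(v)-p(u)$ in the columns of $v$, and zeros elsewhere. The $d$-dimensional rigidity matroid $\mathcal{R}_d(G)$ is the matroid on $E$ defined by linear independence of the rows of $R(G,p)$ for a generic $p$ (it does not depend on the choice of the generic $p$), and $r_d(G)$ denotes its rank. Theorem. Let $d,k$ be integers with $1\le k<d(d+1)$,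 and put $$m_{d,k}=\begin{cases}\dfrac{k}{2} & \text{if } k\le d,\\[2mm] d+\dfrac12-\dfrac12\cdot\dfrac{d(d+1)}{k} & \text{if } d+1\le k<d(d+1).\end{cases}$$ (a) If $G=(V,E)$ is a $k$-connected graph that is not rigid in $\mathbb{R}^d$, then $r_d(G)\ge m_{d,k}|V|$. (b) If $k\ge 2$, then the constant $m_{d,k}$ is best possible, in the following sense: there are infinitely many (that is, arbitrarily large) $k$-connected graphs $G=(V,E)$ that are not rigid in $\mathbb{R}^d$ and satisfy $r_d(G)=m_{d,k}|V|$. -/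

import Mathlib

namespace GraphRigidity

universe u

/-! ## Frameworks -/

section Frameworks

variable {V : Type u} {d : ℕ}

/-- Two `d`-dimensional realisations `p, q` of the graph `G` are equivalent if they give the same
length to every edge of `G`. -/
def Equivalent (G : SimpleGraph V) (p q : V → EuclideanSpace ℝ (Fin d)) : Prop :=
  ∀ u v : V, G.Adj u v → ‖p u - p v‖ = ‖q u - q v‖

/-- Two realisations are congruent if they give the same length to every pair of vertices. -/
def Congruent (p q : V → EuclideanSpace ℝ (Fin d)) : Prop :=
  ∀ u v : V, ‖p u - p v‖ = ‖q u - q v‖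

/-- The framework `(G, p)` is rigid. -/
def FrameworkRigid (G : SimpleGraph V) (p : V → EuclideanSpace ℝ (Fin d)) : Prop :=
  ∃ ε : ℝ, 0 < ε ∧ ∀ q : V → EuclideanSpace ℝ (Fin d),
    Equivalent G p q → (∀ v : V, ‖p v - q v‖ < ε) → Congruent p q

/-- A realisation is generic if its vertex coordinates are algebraically independent over `ℚ`. -/
def IsGeneric (p : V → EuclideanSpace ℝ (Fin d)) : Prop :=
  AlgebraicIndependent ℚ (fun x : V × Fin d => p x.1 x.2)

/-- The graph `G` is rigid in `ℝ^d`: every generic `d`-dimensional framework of `G` is rigid. -/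
def IsRigid (d : ℕ) (G : SimpleGraph V) : Prop :=
  ∀ p : V → EuclideanSpace ℝ (Fin d), IsGeneric p → FrameworkRigid G p

end Frameworks

/-- `G` is `k`-connected: it has more than `k` vertices, and it stays connected whenever fewer
than `k` vertices are deleted. -/
def IsKConnected {V : Type u} (k : ℕ) (G : SimpleGraph V) : Prop :=
  k < Nat.card V ∧ ∀ S : Finset V, S.card < k → (G.induce ((S : Set V)ᶜ)).Connected

/-! ## The rigidity matrix and the rigidity matroid -/

section RigidityMatroid

variable {V : Type u} {d : ℕ}

open Classical in
/-- The row of the rigidity matrix that belongs to the pair `uv`: it is `p u - p v` in the `d`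
columns of `u`, `p v - p u` in the `d` columns of `v`, and zero elsewhere. -/
noncomputable def rigidityRow (p : V → EuclideanSpace ℝ (Fin d)) : Sym2 V → V × Fin d → ℝ :=
  Sym2.lift ⟨fun u v x =>
      (if x.1 = u then p u x.2 - p v x.2 else 0) + (if x.1 = v then p v x.2 - p u x.2 else 0),
    fun u v => by funext x; exact add_comm _ _⟩

/-- The rigidity matrix `R(G, p)`. -/
noncomputable def rigidityMatrix (G : SimpleGraph V) (p : V → EuclideanSpace ℝ (Fin d)) :
    Matrix G.edgeSet (V × Fin d) ℝ :=
  Matrix.of fun e x => rigidityRow p (e : Sym2 V) x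

/-- The rigidity matroid of the framework `(G, p)`: its ground set is the edge set of `G`, and a
set of edges is independent if the corresponding rows of `R(G, p)` are linearly independent. -/
noncomputable def frameworkMatroid [Finite V] (G : SimpleGraph V)
    (p : V → EuclideanSpace ℝ (Fin d)) : Matroid (Sym2 V) :=
  (IndepMatroid.ofFinite (E := G.edgeSet) (Set.toFinite _)
    (fun I => I ⊆ G.edgeSet ∧ LinearIndepOn ℝ (rigidityRow p) I)
    ⟨Set.empty_subset _, linearIndepOn_empty _ _⟩
    (fun _ _ hJ hIJ => ⟨hIJ.trans hJ.1, hJ.2.mono hIJ⟩)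
    (by
      rintro I J ⟨hIE, hI⟩ ⟨hJE, hJ⟩ hlt
      by_contra! hcon
      have hsub : rigidityRow p '' J ⊆ Submodule.span ℝ (rigidityRow p '' I) := by
        rintro _ ⟨e, he, rfl⟩
        by_cases heI : e ∈ I
        · exact Submodule.subset_span ⟨e, heI, rfl⟩
        · by_contra hspan
          exact hcon e he heI (Set.insert_subset (hJE he) hIE) (hI.insert hspan)
      have hI' := Module.finrank_eq_nat_card_basis (Module.Basis.span hI)
      have hJ' := Module.finrank_eq_nat_card_basis (Module.Basis.span hJ)
      rw [← Set.image_eq_range] at hI' hJ'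
      have hle := Submodule.finrank_mono (Submodule.span_le.2 hsub)
      rw [hI', hJ', Nat.card_coe_set_eq, Nat.card_coe_set_eq] at hle
      omega)
    (fun _ hI => hI.1)).matroid

theorem frameworkMatroid_indep_iff [Finite V] (G : SimpleGraph V)
    (p : V → EuclideanSpace ℝ (Fin d)) (I : Set (Sym2 V)) :
    (frameworkMatroid G p).Indep I ↔ I ⊆ G.edgeSet ∧ LinearIndepOn ℝ (rigidityRow p) I := by
  simp [frameworkMatroid]

theorem frameworkMatroid_ground [Finite V] (G : SimpleGraph V)
    (p : V → EuclideanSpace ℝ (Fin d)) : (frameworkMatroid G p).E = G.edgeSet := rfl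

theorem exists_isGeneric (V : Type u) [Finite V] (d : ℕ) :
    ∃ p : V → EuclideanSpace ℝ (Fin d), IsGeneric p := by
  obtain ⟨s, hs⟩ := exists_isTranscendenceBasis ℚ ℝ
  have hinf : Infinite s := by
    rw [← not_finite_iff_infinite]
    intro hfin
    have := hs.isAlgebraic
    have hc : Countable (Algebra.adjoin ℚ (Set.range ((↑) : s → ℝ))) := by
      rw [← Cardinal.mk_le_aleph0_iff]
      have h1 := (hs.1.aevalEquiv).toEquiv.cardinal_eq
      rw [← h1]
      exact MvPolynomial.cardinalMk_le_max.trans (by simp)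
    have h2 := Algebra.IsAlgebraic.cardinalMk_le_max
      (Algebra.adjoin ℚ (Set.range ((↑) : s → ℝ))) ℝ
    rw [Cardinal.mk_real] at h2
    exact absurd (h2.trans (max_le (Cardinal.mk_le_aleph0_iff.2 hc) le_rfl))
      (not_le.2 Cardinal.aleph0_lt_continuum)
  obtain ⟨f⟩ : Nonempty (V × Fin d ↪ s) := by
    cases nonempty_fintype V
    exact ⟨(Fintype.equivFin (V × Fin d)).toEmbedding.trans
      (Fin.valEmbedding.trans (Infinite.natEmbedding s))⟩
  exact ⟨fun v => WithLp.toLp 2 fun i => (f (v, i) : ℝ), hs.1.comp f f.injective⟩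

/-- A generic `d`-dimensional realisation of the vertex set `V`. -/
noncomputable def genericRealisation (V : Type u) [Finite V] (d : ℕ) :
    V → EuclideanSpace ℝ (Fin d) :=
  Classical.choose (exists_isGeneric V d)

theorem isGeneric_genericRealisation (V : Type u) [Finite V] (d : ℕ) :
    IsGeneric (genericRealisation V d) :=
  Classical.choose_spec (exists_isGeneric V d)

/-- The `d`-dimensional rigidity matroid of `G`: the rigidity matroid of a generic framework of
`G`. It does not depend on the generic framework, see `rigidityMatroid_eq`. -/
noncomputable def rigidityMatroid [Finite V] (d : ℕ) (G : SimpleGraph V) : Matroid (Sym2 V) :=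
  frameworkMatroid G (genericRealisation V d)

/-- The rank `r_d(G)` of the `d`-dimensional rigidity matroid of `G`. -/
noncomputable def rigidityRank [Finite V] (d : ℕ) (G : SimpleGraph V) : ℕ :=
  (rigidityMatroid d G).eRank.toNat

open Classical in
/-- The rows of the rigidity matrix with indeterminate coordinates. -/
noncomputable def symbolicRow (V : Type u) (d : ℕ) :
    Sym2 V → V × Fin d → MvPolynomial (V × Fin d) ℚ :=
  Sym2.lift ⟨fun u v x =>
      (if x.1 = u then MvPolynomial.X (u, x.2) - MvPolynomial.X (v, x.2) else 0) +
        (if x.1 = v then MvPolynomial.X (v, x.2) - MvPolynomial.X (u, x.2) else 0),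
    fun u v => by funext x; exact add_comm _ _⟩

theorem aeval_symbolicRow (p : V → EuclideanSpace ℝ (Fin d)) (e : Sym2 V) (x : V × Fin d) :
    MvPolynomial.aeval (fun y : V × Fin d => p y.1 y.2) (symbolicRow V d e x) =
      rigidityRow p e x := by
  induction e using Sym2.ind with
  | h u v =>
    simp only [symbolicRow, rigidityRow, Sym2.lift_mk, map_add]
    split_ifs <;> simp

theorem linearIndepOn_rigidityRow_iff [Finite V] {p : V → EuclideanSpace ℝ (Fin d)}
    (hp : IsGeneric p) (I : Set (Sym2 V)) :
    LinearIndepOn ℝ (rigidityRow p) I ↔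
      ∀ [Fintype V] [Fintype I] [DecidableEq I],
        (Matrix.of (fun e : I => symbolicRow V d e) *
          (Matrix.of (fun e : I => symbolicRow V d e)).transpose).det ≠ 0 := by
  have key : ∀ [Fintype V] [Fintype I] [DecidableEq I],
      LinearIndepOn ℝ (rigidityRow p) I ↔ (Matrix.of (fun e : I => symbolicRow V d e) *
          (Matrix.of (fun e : I => symbolicRow V d e)).transpose).det ≠ 0 := by
    intro _ _ _
    set φ := MvPolynomial.aeval (R := ℚ) (fun y : V × Fin d => p y.1 y.2) with hφ
    set A : Matrix I (V × Fin d) ℝ := Matrix.of (fun e : I => rigidityRow p e) with hA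
    have hmap : A = (Matrix.of (fun e : I => symbolicRow V d e)).map φ := by
      ext e x
      exact (aeval_symbolicRow p e x).symm
    have hdet : (A * A.transpose).det = φ (Matrix.of (fun e : I => symbolicRow V d e) *
          (Matrix.of (fun e : I => symbolicRow V d e)).transpose).det := by
      rw [AlgHom.map_det, hmap, AlgHom.mapMatrix_apply, Matrix.map_mul, Matrix.transpose_map]
    have hinj : Function.Injective φ := hp
    have h1 : LinearIndepOn ℝ (rigidityRow p) I ↔ LinearIndependent ℝ A.row := Iff.rfl
    rw [h1, ← map_ne_zero_iff φ hinj, ← hdet, ← isUnit_iff_ne_zero, ← Matrix.isUnit_iff_isUnit_det,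
      ← Matrix.linearIndependent_rows_iff_isUnit]
    rw [linearIndependent_iff_card_eq_finrank_span, linearIndependent_iff_card_eq_finrank_span]
    rw [Set.finrank, Set.finrank, ← Matrix.rank_eq_finrank_span_row,
      ← Matrix.rank_eq_finrank_span_row, Matrix.rank_self_mul_transpose]
  constructor
  · intro h _ _ _
    exact key.1 h
  · intro h
    classical
    cases nonempty_fintype V
    cases nonempty_fintype I
    exact key.2 h

/-- All generic frameworks of `G` have the same rigidity matroid. -/
theorem rigidityMatroid_eq [Finite V] (G : SimpleGraph V)
    {p : V → EuclideanSpace ℝ (Fin d)} (hp : IsGeneric p) :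
    rigidityMatroid d G = frameworkMatroid G p := by
  refine Matroid.ext_indep rfl fun I _ => ?_
  rw [rigidityMatroid, frameworkMatroid_indep_iff, frameworkMatroid_indep_iff,
    linearIndepOn_rigidityRow_iff (isGeneric_genericRealisation V d),
    linearIndepOn_rigidityRow_iff hp]

/-- `r_d(G)` is the rank of the rigidity matrix of any generic framework of `G`. -/
theorem rigidityRank_eq_rank [Fintype V] (G : SimpleGraph V)
    {p : V → EuclideanSpace ℝ (Fin d)} (hp : IsGeneric p) :
    rigidityRank d G = (rigidityMatrix G p).rank := by
  rw [rigidityRank, rigidityMatroid_eq G hp]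
  obtain ⟨B, hB⟩ := (frameworkMatroid G p).exists_isBase
  obtain ⟨hBE, hBi⟩ := (frameworkMatroid_indep_iff G p B).1 hB.indep
  have hspan : Submodule.span ℝ (Set.range (rigidityMatrix G p).row) =
      Submodule.span ℝ (rigidityRow p '' B) := by
    apply le_antisymm
    · rw [Submodule.span_le]
      rintro _ ⟨⟨e, he⟩, rfl⟩
      by_cases heB : e ∈ B
      · exact Submodule.subset_span ⟨e, heB, rfl⟩
      · by_contra hne
        have hins : (frameworkMatroid G p).Indep (insert e B) :=
          (frameworkMatroid_indep_iff G p _).2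
            ⟨Set.insert_subset he hBE, hBi.insert hne⟩
        exact heB ((hB.eq_of_subset_indep hins (Set.subset_insert e B)) ▸ Set.mem_insert e B)
    · apply Submodule.span_mono
      rintro _ ⟨e, he, rfl⟩
      exact ⟨⟨e, hBE he⟩, rfl⟩
  have hcard := Module.finrank_eq_nat_card_basis (Module.Basis.span hBi)
  rw [← Set.image_eq_range] at hcard
  rw [Matrix.rank_eq_finrank_span_row, hspan, hcard, ← hB.encard_eq_eRank,
    Nat.card_coe_set_eq, Set.ncard_def]

end RigidityMatroid

/-- The constant `m_{d,k}`. -/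
noncomputable def minRankConst (d k : ℕ) : ℝ :=
  if k ≤ d then (k : ℝ) / 2
  else (d : ℝ) + 1 / 2 - 1 / 2 * ((d : ℝ) * ((d : ℝ) + 1) / (k : ℝ))

end GraphRigidity

/-!
The rank of a set of pairs of vertices in a framework is the dimension of the span of the
corresponding rows of the rigidity matrix (`rowRank`). A generic framework maximises all these ranks
(`IsGeneric.rowRank_le`), so lower bounds may be proved in special positions.

Rigidity is a rank condition: a generic framework is rigid if and only if the rows of the edges span
the rows of all pairs. If `q` is equivalent to `p`, then `q - p` is an infinitesimal motion of
`(p + q) / 2`, which gives one direction (`IsGeneric.frameworkRigid`); the other one follows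
from the inverse function theorem (`IsGeneric.not_frameworkRigid`).

For the lower bound, `G` is replaced by its closure, in which every pair that depends on the edges is
an edge; it is complete only if the framework is rigid. Let the vertices arrive in a random order.
A vertex with set `S` of earlier neighbours raises the rank by `min |S| d`, and by `d + 1` if
`|S| > d` and `S` is not a clique (`rankIncrement`): the vertex can be moved to the midpoint of an
unlinked pair. In a closed graph two cliques that share `d` vertices span a clique, because the
complete graph on `d + 2` generic points is a circuit. Hence, if the neighbourhood of a vertex of
degree `D` is not a clique, then for `j > d` a random `j`-subset of it is not a clique with
probability at least `j / D` (`card_filter_powersetCard_le`). As `|S|` is uniform in `{0, …, D}`, the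
expected increment is at least `d + 1 / 2 - d (d + 1) / (2 D)`, which is at least `m_{d,k}` because
`D ≥ k`. A vertex whose neighbourhood is a clique contributes `d > m_{d,k}`, and its removal
preserves the connectivity that is needed, so such vertices are removed first. If `k ≤ d`, then the
expectation of `min |S| d` alone is at least `k / 2`.

The bound is attained by graphs whose vertex set is partitioned into cliques of size `k`, with a
perfect matching as the set of the remaining edges: their rank is at most that of the cliques plus
the number of matching edges, which is `m_{d,k}` per vertex, and this is less than the rank of the
complete graph if there are many vertices. Such a graph is `k`-connected if contracting its cliques
gives a `k`-edge-connected multigraph, such as a cycle with all edges of multiplicity `⌊k / 2⌋`,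
together with the edges between opposite vertices if `k` is odd (`necklace`).
-/

namespace GraphRigidity

universe u

/-! ### Generic position -/

section Generic

/-- A linear independence that holds at some specialisation of the indeterminates holds at every
algebraically independent point. -/
theorem linearIndependent_aeval_of_algebraicIndependent {σ ι J : Type*} [Finite ι] [Finite J]
    {x y : σ → ℝ} (hx : AlgebraicIndependent ℚ x) (M : ι → J → MvPolynomial σ ℚ)
    (h : LinearIndependent ℝ fun i j => MvPolynomial.aeval y (M i j)) :
    LinearIndependent ℝ fun i j => MvPolynomial.aeval x (M i j) := by
  classical
  cases nonempty_fintype ι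
  cases nonempty_fintype J
  have key : ∀ z : σ → ℝ, (LinearIndependent ℝ fun i j => MvPolynomial.aeval z (M i j)) ↔
      MvPolynomial.aeval z (Matrix.of M * (Matrix.of M).transpose).det ≠ 0 := by
    intro z
    set φ := MvPolynomial.aeval (R := ℚ) z with hφ
    set A : Matrix ι J ℝ := (Matrix.of M).map φ with hA
    have hdet : φ (Matrix.of M * (Matrix.of M).transpose).det = (A * A.transpose).det := by
      rw [AlgHom.map_det, AlgHom.mapMatrix_apply, Matrix.map_mul, Matrix.transpose_map]
    have h1 : (LinearIndependent ℝ fun i j => MvPolynomial.aeval z (M i j)) ↔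
      LinearIndependent ℝ A.row := Iff.rfl
    rw [h1, hdet, ← isUnit_iff_ne_zero, ← Matrix.isUnit_iff_isUnit_det,
      ← Matrix.linearIndependent_rows_iff_isUnit]
    rw [linearIndependent_iff_card_eq_finrank_span, linearIndependent_iff_card_eq_finrank_span]
    rw [Set.finrank, Set.finrank, ← Matrix.rank_eq_finrank_span_row,
      ← Matrix.rank_eq_finrank_span_row, Matrix.rank_self_mul_transpose]
  rw [key] at h ⊢
  intro h0
  have hinj : Function.Injective (MvPolynomial.aeval (R := ℚ) x) := hx
  rw [map_eq_zero_iff _ hinj] at h0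
  exact h (by rw [h0, map_zero])

variable {V : Type u} {d : ℕ}

/-- At most `d` edge vectors at a vertex of a generic framework are linearly independent. -/
theorem IsGeneric.linearIndependent_sub {p : V → EuclideanSpace ℝ (Fin d)} (hp : IsGeneric p)
    {v : V} {T : Finset V} (hv : v ∉ T) (hT : T.card ≤ d) :
    LinearIndependent ℝ fun t : T => p v - p t := by
  classical
  let φ : T ↪ Fin d := T.equivFin.toEmbedding.trans (Fin.castLEEmb hT)
  let M : T → Fin d → MvPolynomial (V × Fin d) ℚ := fun t i =>
    MvPolynomial.X (v, i) - MvPolynomial.X ((t : V), i)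
  -- `v` is placed at the origin and the points of `T` at distinct unit vectors
  let y : V × Fin d → ℝ := fun x => if h : x.1 ∈ T then (if x.2 = φ ⟨x.1, h⟩ then -1 else 0) else 0
  have h1 : LinearIndependent ℝ fun (t : T) (i : Fin d) => MvPolynomial.aeval y (M t i) := by
    have : (fun (t : T) (i : Fin d) => MvPolynomial.aeval y (M t i)) =
        fun t => Pi.basisFun ℝ (Fin d) (φ t) := by
      funext t i
      simp only [M, y, map_sub, MvPolynomial.aeval_X, hv, t.2, dite_true, dite_false,
        Pi.basisFun_apply, Pi.single_apply]
      split_ifs <;> simp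
    rw [this]
    exact (Pi.basisFun ℝ (Fin d)).linearIndependent.comp φ φ.injective
  have h2 := linearIndependent_aeval_of_algebraicIndependent hp M h1
  refine LinearIndependent.of_comp (WithLp.linearEquiv 2 ℝ (Fin d → ℝ)).toLinearMap ?_
  have h3 : (fun (t : T) (i : Fin d) => MvPolynomial.aeval (fun x : V × Fin d => p x.1 x.2) (M t i))
      = fun t : T => (p v - p t).ofLp := by
    funext t i
    simp [M]
  rw [h3] at h2
  exact h2

end Generic

/-! ### Spans of rows of the rigidity matrix -/

section Rows

variable {V : Type u} {d : ℕ}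

/-- The span of the rows of the rigidity matrix that belong to the pairs in `F`. -/
noncomputable def rowSpan (p : V → EuclideanSpace ℝ (Fin d)) (F : Set (Sym2 V)) :
    Submodule ℝ (V × Fin d → ℝ) :=
  Submodule.span ℝ (rigidityRow p '' F)

/-- The rank of a set of pairs in the framework `p`. -/
noncomputable def rowRank (p : V → EuclideanSpace ℝ (Fin d)) (F : Set (Sym2 V)) : ℕ :=
  Module.finrank ℝ (rowSpan p F)

theorem rowSpan_mono (p : V → EuclideanSpace ℝ (Fin d)) {F F' : Set (Sym2 V)} (h : F ⊆ F') :
    rowSpan p F ≤ rowSpan p F' :=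
  Submodule.span_mono (Set.image_mono h)

theorem rigidityRow_mem_rowSpan (p : V → EuclideanSpace ℝ (Fin d)) {F : Set (Sym2 V)} {e : Sym2 V}
    (h : e ∈ F) : rigidityRow p e ∈ rowSpan p F :=
  Submodule.subset_span ⟨e, h, rfl⟩

theorem rowSpan_le_iff {p : V → EuclideanSpace ℝ (Fin d)} {F : Set (Sym2 V)}
    {U : Submodule ℝ (V × Fin d → ℝ)} :
    rowSpan p F ≤ U ↔ ∀ e ∈ F, rigidityRow p e ∈ U := by
  rw [rowSpan, Submodule.span_le]
  exact Set.image_subset_iff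

theorem rowSpan_union (p : V → EuclideanSpace ℝ (Fin d)) (F F' : Set (Sym2 V)) :
    rowSpan p (F ∪ F') = rowSpan p F ⊔ rowSpan p F' := by
  rw [rowSpan, Set.image_union, Submodule.span_union]; rfl

theorem rigidityRow_diag (p : V → EuclideanSpace ℝ (Fin d)) (v : V) :
    rigidityRow p s(v, v) = 0 := by
  funext x
  simp [rigidityRow]

theorem exists_subset_rowSpan_eq (p : V → EuclideanSpace ℝ (Fin d)) (F : Set (Sym2 V)) :
    ∃ B ⊆ F, LinearIndepOn ℝ (rigidityRow p) B ∧ rowSpan p B = rowSpan p F := by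
  obtain ⟨B, hBF, -, hsub, hB⟩ := exists_linearIndepOn_extension
    (linearIndepOn_empty ℝ (rigidityRow p)) (Set.empty_subset F)
  exact ⟨B, hBF, hB, le_antisymm (rowSpan_mono p hBF) (Submodule.span_le.2 hsub)⟩

theorem rowRank_eq_ncard {p : V → EuclideanSpace ℝ (Fin d)} {B : Set (Sym2 V)}
    (hB : LinearIndepOn ℝ (rigidityRow p) B) : rowRank p B = B.ncard := by
  have h := Module.finrank_eq_nat_card_basis (Module.Basis.span hB)
  rw [← Set.image_eq_range, Nat.card_coe_set_eq] at h
  exact h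

/-- Restriction of a row vector to the columns of the vertex `v`. -/
def columnsAt (v : V) : (V × Fin d → ℝ) →ₗ[ℝ] (Fin d → ℝ) :=
  LinearMap.funLeft ℝ ℝ fun i => (v, i)

theorem columnsAt_rigidityRow_self (p : V → EuclideanSpace ℝ (Fin d)) {v t : V} (h : v ≠ t) :
    columnsAt v (rigidityRow p s(v, t)) = (p v - p t).ofLp := by
  funext i
  simp [columnsAt, rigidityRow, LinearMap.funLeft_apply, h]

theorem columnsAt_rigidityRow_of_notMem (p : V → EuclideanSpace ℝ (Fin d)) {v : V} {e : Sym2 V}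
    (h : v ∉ e) : columnsAt v (rigidityRow p e) = 0 := by
  induction e using Sym2.ind with
  | h a b =>
    funext i
    have h1 : v ≠ a ∧ v ≠ b := by simpa using h
    simp [columnsAt, rigidityRow, LinearMap.funLeft_apply, h1.1, h1.2]

variable [Finite V]

theorem rowRank_mono (p : V → EuclideanSpace ℝ (Fin d)) {F F' : Set (Sym2 V)} (h : F ⊆ F') :
    rowRank p F ≤ rowRank p F' := by
  cases nonempty_fintype V
  exact Submodule.finrank_mono (rowSpan_mono p h)

theorem rowRank_le_ncard (p : V → EuclideanSpace ℝ (Fin d)) (F : Set (Sym2 V)) :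
    rowRank p F ≤ F.ncard := by
  obtain ⟨B, hBF, hB, hs⟩ := exists_subset_rowSpan_eq p F
  rw [rowRank, ← hs, ← rowRank, rowRank_eq_ncard hB]
  exact Set.ncard_le_ncard hBF (Set.toFinite _)

theorem rowRank_union_le (p : V → EuclideanSpace ℝ (Fin d)) (F F' : Set (Sym2 V)) :
    rowRank p (F ∪ F') ≤ rowRank p F + rowRank p F' := by
  cases nonempty_fintype V
  rw [rowRank, rowSpan_union]
  exact Submodule.finrank_add_le_finrank_add_finrank _ _

theorem IsGeneric.linearIndepOn {p : V → EuclideanSpace ℝ (Fin d)} (hp : IsGeneric p)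
    {q : V → EuclideanSpace ℝ (Fin d)} {I : Set (Sym2 V)}
    (h : LinearIndepOn ℝ (rigidityRow q) I) : LinearIndepOn ℝ (rigidityRow p) I := by
  have := linearIndependent_aeval_of_algebraicIndependent (ι := I) hp
    (y := fun y : V × Fin d => q y.1 y.2) (fun e => symbolicRow V d e)
  simp only [aeval_symbolicRow] at this
  exact this h

/-- Generic frameworks maximise the rank of every set of pairs. -/
theorem IsGeneric.rowRank_le {p : V → EuclideanSpace ℝ (Fin d)} (hp : IsGeneric p)
    (q : V → EuclideanSpace ℝ (Fin d)) (F : Set (Sym2 V)) : rowRank q F ≤ rowRank p F := by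
  obtain ⟨B, hBF, hB, hs⟩ := exists_subset_rowSpan_eq q F
  rw [rowRank, ← hs, ← rowRank, rowRank_eq_ncard hB, ← rowRank_eq_ncard (hp.linearIndepOn hB)]
  exact rowRank_mono p hBF

theorem finrank_add_finrank_map_le {K E F : Type*} [DivisionRing K]
    [AddCommGroup E] [Module K E] [FiniteDimensional K E] [AddCommGroup F] [Module K F]
    (f : E →ₗ[K] F) {W₀ W : Submodule K E} (h : W₀ ≤ W) (hker : W₀ ≤ LinearMap.ker f) :
    Module.finrank K W₀ + Module.finrank K (W.map f) ≤ Module.finrank K W := by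
  have h1 := LinearMap.finrank_range_add_finrank_ker (f.domRestrict W)
  have h2 : LinearMap.range (f.domRestrict W) = W.map f := LinearMap.range_domRestrict _ _
  have h3 : Module.finrank K W₀ ≤ Module.finrank K (LinearMap.ker (f.domRestrict W)) := by
    refine LinearMap.finrank_le_finrank_of_injective
      (f := LinearMap.codRestrict (LinearMap.ker (f.domRestrict W)) (Submodule.inclusion h) ?_) ?_
    · intro x
      exact hker x.2
    · intro x y hxy
      exact Submodule.inclusion_injective h (congrArg Subtype.val hxy)
  rw [h2] at h1
  omega

/-- Adding edges from `v` to `T` raises the rank by at least the size of `T`, provided that the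
edge vectors are independent and that the old pairs avoid `v`. -/
theorem rowRank_add_card_le {q : V → EuclideanSpace ℝ (Fin d)} {v : V} {T : Finset V}
    (hv : v ∉ T) (hT : LinearIndependent ℝ fun t : T => q v - q t) {F₀ F : Set (Sym2 V)}
    (hF₀ : ∀ e ∈ F₀, v ∉ e) (h0 : rowSpan q F₀ ≤ rowSpan q F)
    (h1 : ∀ t ∈ T, s(v, t) ∈ F) : rowRank q F₀ + T.card ≤ rowRank q F := by
  cases nonempty_fintype V
  refine le_trans ?_ (finrank_add_finrank_map_le (columnsAt v) h0 ?_)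
  · refine Nat.add_le_add le_rfl ?_
    have h2 : LinearIndependent ℝ fun t : T => (q v - q t).ofLp :=
      hT.map' (WithLp.linearEquiv 2 ℝ (Fin d → ℝ)).toLinearMap (LinearEquiv.ker _)
    have h3 := finrank_span_eq_card h2
    rw [Fintype.card_coe] at h3
    rw [← h3]
    refine Submodule.finrank_mono (Submodule.span_le.2 ?_)
    rintro _ ⟨t, rfl⟩
    refine ⟨_, rigidityRow_mem_rowSpan q (h1 t t.2), ?_⟩
    exact columnsAt_rigidityRow_self q fun h => hv (h ▸ t.2)
  · rw [rowSpan_le_iff]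
    exact fun e he => columnsAt_rigidityRow_of_notMem q (hF₀ e he)

end Rows

/-! ### Rank increments of vertex additions -/

section Extension

variable {V : Type u} {d : ℕ}

theorem rigidityRow_congr {p q : V → EuclideanSpace ℝ (Fin d)} {e : Sym2 V}
    (h : ∀ x ∈ e, p x = q x) : rigidityRow p e = rigidityRow q e := by
  induction e using Sym2.ind with
  | h a b =>
    have ha := h a (by simp)
    have hb := h b (by simp)
    simp only [rigidityRow, Sym2.lift_mk, ha, hb]

theorem rowSpan_congr {p q : V → EuclideanSpace ℝ (Fin d)} {F : Set (Sym2 V)}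
    (h : ∀ e ∈ F, ∀ x ∈ e, p x = q x) : rowSpan p F = rowSpan q F := by
  rw [rowSpan, rowSpan, Set.image_congr fun e he => rigidityRow_congr (h e he)]

/-- If `v` is the midpoint of `u` and `w`, then the pair `uw` is dependent on `vu` and `vw`. -/
theorem rigidityRow_eq_of_midpoint {q : V → EuclideanSpace ℝ (Fin d)} {u v w : V}
    (hv : q v = (2⁻¹ : ℝ) • (q u + q w)) :
    rigidityRow q s(u, w) = (2 : ℝ) • (rigidityRow q s(v, u) + rigidityRow q s(v, w)) := by
  funext x
  simp only [rigidityRow, Sym2.lift_mk, Pi.smul_apply, Pi.add_apply, hv, PiLp.smul_apply,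
    PiLp.add_apply, smul_eq_mul]
  split_ifs <;> ring

/-- Adding a vertex `v` with more than `d` neighbours, two of which are not linked yet, raises the
rank by at least `d + 1`: this is seen by moving `v` to the midpoint of the unlinked pair, as a
generic framework has at least the rank of a special one. -/
theorem IsGeneric.rowRank_add_succ_le [Finite V] {p : V → EuclideanSpace ℝ (Fin d)}
    (hp : IsGeneric p) (hd : 1 ≤ d) {v u w : V} {N : Finset V} (hv : v ∉ N) (hN : d < N.card)
    {F₀ F : Set (Sym2 V)} (hF₀ : ∀ e ∈ F₀, v ∉ e) (hsub : F₀ ⊆ F) (hF : ∀ t ∈ N, s(v, t) ∈ F)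
    (hu : u ∈ N) (hw : w ∈ N) (huw : rigidityRow p s(u, w) ∉ rowSpan p F₀) :
    rowRank p F₀ + (d + 1) ≤ rowRank p F := by
  classical
  cases nonempty_fintype V
  have hne : u ≠ w := by
    rintro rfl
    exact huw (by rw [rigidityRow_diag]; exact zero_mem _)
  have huv : u ≠ v := fun h => hv (h ▸ hu)
  have hwv : w ≠ v := fun h => hv (h ▸ hw)
  obtain ⟨T, hTN, hTc⟩ : ∃ T ⊆ (N.erase u).erase w, T.card = d - 1 := by
    apply Finset.exists_subset_card_eq
    rw [Finset.card_erase_of_mem (Finset.mem_erase.2 ⟨hne.symm, hw⟩), Finset.card_erase_of_mem hu]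
    omega
  have hTsub : ∀ t ∈ T, t ≠ w ∧ t ≠ u ∧ t ∈ N := by
    intro t ht
    simpa using hTN ht
  have huT : u ∉ T := fun h => (hTsub u h).2.1 rfl
  have hTc' : (insert u T).card = d := by
    rw [Finset.card_insert_of_notMem huT, hTc]; omega
  have hTN' : ∀ t ∈ insert u T, t ∈ N := by
    intro t ht
    rcases Finset.mem_insert.1 ht with rfl | h
    · exact hu
    · exact (hTsub t h).2.2
  set q := Function.update p v ((2⁻¹ : ℝ) • (p u + p w)) with hq
  have hqv : q v = (2⁻¹ : ℝ) • (p u + p w) := by simp [hq]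
  have hqx : ∀ x, x ≠ v → q x = p x := fun x hx => by simp [hq, hx]
  have hind : LinearIndependent ℝ fun t : (insert u T : Finset V) => q v - q t := by
    have h1 : LinearIndepOn ℝ (fun t => p w - p t) ((insert u T : Finset V) : Set V) :=
      hp.linearIndependent_sub (by simpa [hne.symm] using fun h => (hTsub w h).1 rfl) hTc'.le
    rw [linearIndepOn_finset_iff] at h1
    change LinearIndepOn ℝ (fun t => q v - q t) ((insert u T : Finset V) : Set V)
    rw [linearIndepOn_finset_iff]
    intro g hg
    rw [Finset.sum_insert huT, hqv, hqx u huv] at hg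
    have hsum : ∑ t ∈ T, g t • ((2⁻¹ : ℝ) • (p u + p w) - q t) =
        ∑ t ∈ T, g t • (p w - p t) - ((2⁻¹ : ℝ) * ∑ t ∈ T, g t) • (p w - p u) := by
      rw [Finset.mul_sum, Finset.sum_smul, ← Finset.sum_sub_distrib]
      refine Finset.sum_congr rfl fun t ht => ?_
      rw [hqx t fun h => hv (h ▸ (hTsub t ht).2.2)]
      module
    have h2 := h1 (fun t => if t = u then 2⁻¹ * (g u - ∑ t ∈ T, g t) else g t) ?_
    · have h3 : ∀ t ∈ T, g t = 0 := by
        intro t ht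
        simpa [(hTsub t ht).2.1] using h2 t (Finset.mem_insert_of_mem ht)
      intro t ht
      rcases Finset.mem_insert.1 ht with rfl | h
      · have := h2 t (Finset.mem_insert_self _ _)
        rw [Finset.sum_eq_zero h3] at this
        simpa using this
      · exact h3 t h
    · rw [Finset.sum_insert huT]
      have h4 : ∑ t ∈ T, (if t = u then 2⁻¹ * (g u - ∑ t ∈ T, g t) else g t) • (p w - p t) =
          ∑ t ∈ T, g t • (p w - p t) :=
        Finset.sum_congr rfl fun t ht => by rw [if_neg (hTsub t ht).2.1]
      rw [h4, if_pos rfl]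
      rw [hsum] at hg
      rw [← hg]
      module
  have hle : rowRank p F₀ + 1 ≤ rowRank q (insert s(u, w) F₀) := by
    have h1 : rowSpan q (insert s(u, w) F₀) = rowSpan p (insert s(u, w) F₀) := by
      refine rowSpan_congr ?_
      rintro e (rfl | he) x hx
      · rcases Sym2.mem_iff.1 hx with rfl | rfl
        · exact hqx _ huv
        · exact hqx _ hwv
      · exact hqx x fun h => hF₀ e he (h ▸ hx)
    rw [rowRank, rowRank, h1]
    refine Submodule.finrank_lt_finrank_of_lt (lt_of_le_of_ne
      (rowSpan_mono p (Set.subset_insert _ _)) fun h => huw ?_)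
    rw [h]
    exact rigidityRow_mem_rowSpan p (Set.mem_insert _ _)
  have hmain : rowRank q (insert s(u, w) F₀) + (insert u T).card ≤ rowRank q F := by
    refine rowRank_add_card_le (v := v) (fun h => hv (hTN' v h)) hind ?_ ?_
      fun t ht => hF t (hTN' t ht)
    · rintro e (rfl | he)
      · simp [huv.symm, hwv.symm]
      · exact hF₀ e he
    · rw [rowSpan_le_iff]
      rintro e (rfl | he)
      · rw [rigidityRow_eq_of_midpoint (v := v) (by rw [hqv, hqx u huv, hqx w hwv])]
        exact Submodule.smul_mem _ _ (Submodule.add_mem _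
          (rigidityRow_mem_rowSpan q (hF u hu)) (rigidityRow_mem_rowSpan q (hF w hw)))
      · exact rigidityRow_mem_rowSpan q (hsub he)
  have := hp.rowRank_le q F
  omega

end Extension

/-! ### Merging rigid clusters -/

section Merge

variable {V : Type u} {d : ℕ}

/-- An affine dependence `c` of the points of `X` yields the equilibrium stress `c x * c y` of the
complete graph on `X`. -/
theorem sum_stress_eq_zero (p : V → EuclideanSpace ℝ (Fin d)) (X : Finset V) (c : V → ℝ)
    (h0 : ∑ x ∈ X, c x = 0) (h1 : ∑ x ∈ X, c x • p x = 0) :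
    ∑ x ∈ X, ∑ y ∈ X, (c x * c y) • rigidityRow p s(x, y) = 0 := by
  classical
  have h1' : ∀ i, ∑ x ∈ X, c x * p x i = 0 := by
    intro i
    have := congrArg (fun z : EuclideanSpace ℝ (Fin d) => z i) h1
    simpa using this
  funext ⟨z, i⟩
  have key : ∀ a : V, ∑ y ∈ X, c a * c y * (p a i - p y i) = 0 := by
    intro a
    have : ∀ y, c a * c y * (p a i - p y i) = c a * p a i * c y - c a * (c y * p y i) :=
      fun y => by ring
    simp only [this, Finset.sum_sub_distrib, ← Finset.mul_sum, h0, h1' i]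
    simp
  simp only [Finset.sum_apply, Pi.smul_apply, rigidityRow, Sym2.lift_mk, smul_eq_mul, mul_add,
    Finset.sum_add_distrib, Pi.zero_apply]
  have e1 : ∑ x ∈ X, ∑ y ∈ X, c x * c y * (if z = x then p x i - p y i else 0) = 0 := by
    refine Finset.sum_eq_zero fun x _ => ?_
    by_cases hz : z = x
    · simpa [hz] using key x
    · simp [hz]
  have e2 : ∑ x ∈ X, ∑ y ∈ X, c x * c y * (if z = y then p y i - p x i else 0) = 0 := by
    rw [Finset.sum_comm]
    refine Finset.sum_eq_zero fun y _ => ?_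
    by_cases hz : z = y
    · have := key y
      simp only [hz, if_true]
      rw [← this]
      exact Finset.sum_congr rfl fun x _ => by ring
    · simp [hz]
  rw [e1, e2, add_zero]

/-- The complete graph on `d + 2` generic points is a circuit, in the following form: the pair `ab`
depends on the remaining pairs of `T ∪ {a, b}`. -/
theorem IsGeneric.rigidityRow_mem_of_card_eq {p : V → EuclideanSpace ℝ (Fin d)} (hp : IsGeneric p)
    (U : Submodule ℝ (V × Fin d → ℝ)) {a b : V} {T : Finset V} (hT : T.card = d) (ha : a ∉ T)
    (hb : b ∉ T) (hTT : ∀ s ∈ T, ∀ t ∈ T, s ≠ t → rigidityRow p s(s, t) ∈ U)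
    (haT : ∀ t ∈ T, rigidityRow p s(a, t) ∈ U) (hbT : ∀ t ∈ T, rigidityRow p s(b, t) ∈ U) :
    rigidityRow p s(a, b) ∈ U := by
  classical
  by_cases hab : a = b
  · subst hab
    rw [rigidityRow_diag]
    exact zero_mem _
  have hA := hp.linearIndependent_sub ha hT.le
  have hB : LinearIndepOn ℝ (fun t => p b - p t) (T : Set V) := hp.linearIndependent_sub hb hT.le
  rw [linearIndepOn_finset_iff] at hB
  have hspan : p a - p b ∈ Submodule.span ℝ (Set.range fun t : T => p a - p t) := by
    rw [hA.span_eq_top_of_card_eq_finrank' (by simp [hT])]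
    trivial
  obtain ⟨g, hg⟩ := (Submodule.mem_span_range_iff_exists_fun ℝ).1 hspan
  obtain ⟨l, hl⟩ : ∃ l : V → ℝ, ∑ t ∈ T, l t • (p a - p t) = p a - p b := by
    refine ⟨fun t => if h : t ∈ T then g ⟨t, h⟩ else 0, ?_⟩
    rw [← Finset.sum_coe_sort, ← hg]
    simp
  -- the dependence has coefficients `1 - ∑ l` at `a`, `-1` at `b`, and `l` on `T`
  have hsum : ∑ t ∈ T, l t ≠ 1 := by
    intro h1
    have h2 : ∑ t ∈ T, l t • (p b - p t) = 0 := by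
      have e : ∀ t ∈ T, l t • (p b - p t) = l t • (p a - p t) - l t • (p a - p b) :=
        fun t _ => by module
      rw [Finset.sum_congr rfl e, Finset.sum_sub_distrib, hl, ← Finset.sum_smul, h1, one_smul,
        sub_self]
    have h3 := hB l h2
    rw [Finset.sum_eq_zero h3] at h1
    exact zero_ne_one h1
  set c : V → ℝ := fun x => if x = a then 1 - ∑ t ∈ T, l t else if x = b then -1 else l x with hc
  have hca : c a = 1 - ∑ t ∈ T, l t := by simp [hc]
  have hcb : c b = -1 := by simp [hc, Ne.symm hab]
  have hcT : ∀ t ∈ T, c t = l t := by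
    intro t ht
    have h1 : t ≠ a := fun h => ha (h ▸ ht)
    have h2 : t ≠ b := fun h => hb (h ▸ ht)
    simp [hc, h1, h2]
  have haX : a ∉ insert b T := by simp [hab, ha]
  have hstress := sum_stress_eq_zero p (insert a (insert b T)) c
    (by
      rw [Finset.sum_insert haX, Finset.sum_insert hb, hca, hcb, Finset.sum_congr rfl hcT]
      ring)
    (by
      have h5 : ∑ t ∈ T, c t • p t = ∑ t ∈ T, l t • p t :=
        Finset.sum_congr rfl fun t ht => by rw [hcT t ht]
      rw [Finset.sum_insert haX, Finset.sum_insert hb, hca, hcb, h5]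
      have h4 : ∑ t ∈ T, l t • p t = (∑ t ∈ T, l t) • p a - (p a - p b) := by
        rw [← hl, Finset.sum_smul, ← Finset.sum_sub_distrib]
        exact Finset.sum_congr rfl fun t _ => by module
      rw [h4]
      module)
  have hz : ∀ x ∈ insert a (insert b T), ∀ y ∈ insert a (insert b T),
      s(x, y) ≠ s(a, b) → U.mkQ (rigidityRow p s(x, y)) = 0 := by
    intro x hx y hy hxy
    by_cases hxy' : x = y
    · subst hxy'
      rw [rigidityRow_diag, map_zero]
    rw [Submodule.mkQ_apply, Submodule.Quotient.mk_eq_zero]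
    simp only [Finset.mem_insert] at hx hy
    rcases hx with rfl | rfl | hx <;> rcases hy with rfl | rfl | hy
    · exact absurd rfl hxy'
    · exact absurd rfl hxy
    · exact haT y hy
    · exact absurd Sym2.eq_swap hxy
    · exact absurd rfl hxy'
    · exact hbT y hy
    · rw [Sym2.eq_swap]; exact haT x hx
    · rw [Sym2.eq_swap]; exact hbT x hx
    · exact hTT x hx y hy hxy'
  have hQ := congrArg U.mkQ hstress
  simp only [map_sum, map_smul, map_zero] at hQ
  have hrow : ∀ x ∈ T, ∑ y ∈ insert a (insert b T), (c x * c y) • U.mkQ (rigidityRow p s(x, y))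
      = 0 := by
    intro x hx
    refine Finset.sum_eq_zero fun y hy => ?_
    rw [hz x (by simp [hx]) y hy, smul_zero]
    intro h
    have : x ∈ s(a, b) := h ▸ Sym2.mem_mk_left x y
    rcases Sym2.mem_iff.1 this with rfl | rfl
    · exact ha hx
    · exact hb hx
  have hra : ∑ y ∈ insert a (insert b T), (c a * c y) • U.mkQ (rigidityRow p s(a, y)) =
      (c a * c b) • U.mkQ (rigidityRow p s(a, b)) := by
    refine Finset.sum_eq_single b (fun y hy hyb => ?_) (fun h => absurd (by simp) h)
    rw [hz a (by simp) y hy, smul_zero]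
    simp [hyb, hab]
  have hrb : ∑ y ∈ insert a (insert b T), (c b * c y) • U.mkQ (rigidityRow p s(b, y)) =
      (c b * c a) • U.mkQ (rigidityRow p s(a, b)) := by
    rw [Sym2.eq_swap (a := a)]
    refine Finset.sum_eq_single a (fun y hy hya => ?_) (fun h => absurd (by simp) h)
    rw [hz b (by simp) y hy, smul_zero]
    rw [Sym2.eq_swap]
    simp [hya, Ne.symm hab]
  rw [Finset.sum_insert haX, Finset.sum_insert hb, Finset.sum_eq_zero hrow, add_zero, hra, hrb,
    ← add_smul, smul_eq_zero] at hQ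
  rcases hQ with hQ | hQ
  · exfalso
    rw [hca, hcb] at hQ
    apply hsum
    linarith
  · rwa [Submodule.mkQ_apply, Submodule.Quotient.mk_eq_zero] at hQ

end Merge

/-! ### Random orderings -/

section Average

variable {V : Type u}

/-- The expectation of `g` at a random subset of `N` whose size is uniform in `{0, …, |N|}` and
which is uniform among the subsets of that size. This is the set of the elements of `N` that precede
`v ∉ N` in a uniformly random ordering. -/
noncomputable def prefixAverage (g : Finset V → ℝ) (N : Finset V) : ℝ :=
  ∑ S ∈ N.powerset, ((S.card.factorial * (N.card - S.card).factorial : ℕ) : ℝ) /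
    ((N.card + 1).factorial : ℝ) * g S

theorem prefixAverage_eq_sum_range (g : Finset V → ℝ) (N : Finset V) :
    (N.card + 1 : ℝ) * prefixAverage g N = ∑ j ∈ Finset.range (N.card + 1),
      (∑ S ∈ N.powersetCard j, g S) / (N.card.choose j : ℝ) := by
  rw [prefixAverage, Finset.sum_powerset, Finset.mul_sum]
  refine Finset.sum_congr rfl fun j hj => ?_
  rw [Finset.mul_sum, Finset.sum_div]
  refine Finset.sum_congr rfl fun S hS => ?_
  have hj' : j ≤ N.card := by simpa [Nat.lt_succ_iff] using hj
  rw [(Finset.mem_powersetCard.1 hS).2]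
  have h1 := Nat.choose_mul_factorial_mul_factorial hj'
  have h2 : (N.card.choose j : ℝ) ≠ 0 := by
    exact_mod_cast (Nat.choose_pos hj').ne'
  have h3 : (N.card.choose j : ℝ) * (j.factorial : ℝ) * ((N.card - j).factorial : ℝ) =
    (N.card.factorial : ℝ) := by exact_mod_cast h1
  rw [Nat.factorial_succ]
  push_cast
  rw [← h3]
  field_simp

variable [DecidableEq V]

/-- The recursion obtained by conditioning on the last element of the ordering of `N ∪ {v}`. -/
theorem card_add_one_mul_prefixAverage (g : Finset V → ℝ) (N : Finset V) :
    (N.card + 1 : ℝ) * prefixAverage g N = g N + ∑ x ∈ N, prefixAverage g (N.erase x) := by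
  have h1 : ∑ x ∈ N, prefixAverage g (N.erase x) =
      ∑ S ∈ N.powerset.erase N, ((S.card.factorial * (N.card - S.card).factorial : ℕ) : ℝ) /
        (N.card.factorial : ℝ) * g S := by
    have e1 : ∀ x ∈ N, prefixAverage g (N.erase x) = ∑ S ∈ N.powerset.erase N,
        if x ∉ S then ((S.card.factorial * (N.card - 1 - S.card).factorial : ℕ) : ℝ) /
          (N.card.factorial : ℝ) * g S else 0 := by
      intro x hx
      have hc : 1 ≤ N.card := Finset.card_pos.2 ⟨x, hx⟩
      rw [prefixAverage, ← Finset.sum_filter, Finset.card_erase_of_mem hx, Nat.sub_add_cancel hc]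
      refine Finset.sum_congr ?_ fun _ _ => rfl
      ext S
      simp only [Finset.mem_powerset, Finset.mem_filter, Finset.mem_erase, Finset.subset_erase]
      constructor
      · rintro ⟨h1, h2⟩
        exact ⟨⟨fun h => h2 (h ▸ hx), h1⟩, h2⟩
      · rintro ⟨⟨-, h1⟩, h2⟩
        exact ⟨h1, h2⟩
    rw [Finset.sum_congr rfl e1, Finset.sum_comm]
    refine Finset.sum_congr rfl fun S hS => ?_
    rw [Finset.mem_erase, Finset.mem_powerset] at hS
    have hlt : S.card < N.card :=
      Finset.card_lt_card (Finset.ssubset_iff_subset_ne.2 ⟨hS.2, hS.1⟩)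
    rw [← Finset.sum_filter, Finset.sum_const]
    have e2 : (N.filter fun x => x ∉ S).card = N.card - S.card := by
      rw [← Finset.card_sdiff_of_subset hS.2]
      congr 1
      ext x; simp
    rw [e2, nsmul_eq_mul]
    obtain ⟨m, hm⟩ : ∃ m, N.card - S.card = m + 1 := ⟨N.card - S.card - 1, by omega⟩
    have hm' : N.card - 1 - S.card = m := by omega
    rw [hm, hm', Nat.factorial_succ]
    push_cast
    ring
  have hf : (N.card.factorial : ℝ) ≠ 0 := by positivity
  rw [h1, prefixAverage, ← Finset.add_sum_erase _ _ (Finset.mem_powerset_self N), mul_add,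
    Finset.mul_sum]
  congr 1
  · rw [Nat.factorial_succ]
    push_cast
    rw [Nat.sub_self, Nat.factorial_zero]
    field_simp
    simp
  · refine Finset.sum_congr rfl fun S _ => ?_
    rw [Nat.factorial_succ]
    push_cast
    field_simp

/-- If adding `v` to `A` raises `r` by at least `g v` of the neighbours of `v` in `A`, then adding
the vertices in a random order bounds `r` from below by the sum of the expected increments. -/
theorem sum_prefixAverage_le (r : Finset V → ℝ) (h0 : 0 ≤ r ∅) (g : V → Finset V → ℝ)
    (N : V → Finset V) (hN : ∀ v, v ∉ N v)
    (h : ∀ A : Finset V, ∀ v ∈ A, r (A.erase v) + g v (N v ∩ A) ≤ r A) (A : Finset V) :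
    ∑ v ∈ A, prefixAverage (g v) (N v ∩ A) ≤ r A := by
  induction A using Finset.strongInduction with
  | H A ih =>
    rcases A.eq_empty_or_nonempty with rfl | hA
    · simpa using h0
    have hpos : (0 : ℝ) < A.card := by exact_mod_cast hA.card_pos
    refine le_of_mul_le_mul_left ?_ hpos
    have e1 : (A.card : ℝ) * r A = ∑ v ∈ A, r A := by simp
    have e2 : ∀ u ∈ A, (A.card : ℝ) * prefixAverage (g u) (N u ∩ A) = g u (N u ∩ A) +
        ∑ v ∈ A.erase u, prefixAverage (g u) (N u ∩ A.erase v) := by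
      intro u hu
      have hsub : N u ∩ A ⊆ A.erase u := by
        intro x hx
        rw [Finset.mem_inter] at hx
        exact Finset.mem_erase.2 ⟨fun h => hN u (h ▸ hx.1), hx.2⟩
      have e3 := card_add_one_mul_prefixAverage (g u) (N u ∩ A)
      rw [← Finset.sum_sdiff hsub]
      have e4 : ∀ v ∈ A.erase u \ (N u ∩ A),
          prefixAverage (g u) (N u ∩ A.erase v) = prefixAverage (g u) (N u ∩ A) := by
        intro v hv
        rw [Finset.inter_erase, Finset.erase_eq_of_notMem]
        exact (Finset.mem_sdiff.1 hv).2
      rw [Finset.sum_congr rfl e4, Finset.sum_const, Finset.card_sdiff_of_subset hsub,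
        Finset.card_erase_of_mem hu, nsmul_eq_mul]
      have hle := Finset.card_le_card hsub
      rw [Finset.card_erase_of_mem hu] at hle
      have h1 : 1 ≤ A.card := hA.card_pos
      rw [Nat.cast_sub hle, Nat.cast_sub h1]
      have e5 : ∑ v ∈ N u ∩ A, prefixAverage (g u) (N u ∩ A.erase v) =
          ∑ v ∈ N u ∩ A, prefixAverage (g u) ((N u ∩ A).erase v) :=
        Finset.sum_congr rfl fun v _ => by rw [Finset.inter_erase]
      rw [e5]
      push_cast
      linarith
    rw [Finset.mul_sum, Finset.sum_congr rfl e2, e1, Finset.sum_add_distrib]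
    have e6 : ∑ u ∈ A, ∑ v ∈ A.erase u, prefixAverage (g u) (N u ∩ A.erase v) =
        ∑ v ∈ A, ∑ u ∈ A.erase v, prefixAverage (g u) (N u ∩ A.erase v) := by
      refine Finset.sum_comm' fun x y => ?_
      simp only [Finset.mem_erase]
      tauto
    rw [e6, ← Finset.sum_add_distrib]
    refine Finset.sum_le_sum fun v hv => ?_
    have := ih (A.erase v) (Finset.erase_ssubset hv)
    have := h A v hv
    linarith

end Average

/-! ### Counting subsets that do not span -/

section Counting

variable {V : Type u} [DecidableEq V]

/-- Let `P` be a family of subsets of `N` closed under unions of two members that share at least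
`t` elements. If `N` itself is not a member, then for `j > t` at most as many `j`-subsets of `N` are
members as avoid a given element. The members that avoid `x` and those that contain `x` are counted
separately by induction; the latter, with `x` removed, form such a family for `t - 1`. The case
`j = 0` is there for the induction. -/
theorem card_filter_powersetCard_le (N : Finset V) (P : Finset V → Prop) [DecidablePred P]
    (t j : ℕ) (hj : j = 0 ∨ t < j)
    (hP : ∀ A ⊆ N, ∀ B ⊆ N, P A → P B → t ≤ (A ∩ B).card → P (A ∪ B)) (hN : ¬ P N) :
    ((N.powersetCard j).filter P).card ≤ (N.card - 1).choose j := by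
  induction N using Finset.induction_on generalizing P t j with
  | empty =>
    rcases hj with rfl | hj
    · simpa using Finset.card_filter_le {∅} P
    · have : j ≠ 0 := by omega
      obtain ⟨i, rfl⟩ := Nat.exists_eq_succ_of_ne_zero this
      simp
  | insert x M hx ih =>
    rw [Finset.card_insert_of_notMem hx, Nat.add_sub_cancel]
    rcases hj with rfl | hj
    · simpa using Finset.card_filter_le {∅} P
    obtain ⟨i, rfl⟩ := Nat.exists_eq_succ_of_ne_zero (by omega : j ≠ 0)
    rw [Finset.powersetCard_succ_insert hx, Finset.filter_union]
    refine (Finset.card_union_le _ _).trans ?_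
    have hlink : (((M.powersetCard i).image (insert x)).filter P).card =
        ((M.powersetCard i).filter fun S => P (insert x S)).card := by
      rw [Finset.filter_image, Finset.card_image_of_injOn]
      intro S hS S' hS' h
      have h1 : x ∉ S := fun h =>
        hx ((Finset.mem_powersetCard.1 (Finset.mem_filter.1 hS).1).1 h)
      have h2 : x ∉ S' := fun h =>
        hx ((Finset.mem_powersetCard.1 (Finset.mem_filter.1 hS').1).1 h)
      have h3 : insert x S = insert x S' := h
      rw [← Finset.erase_insert h1, h3, Finset.erase_insert h2]
    rw [hlink]
    by_cases hM : P M
    · -- a member that contains `x` would merge with `M` into `N`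
      have h0 : ((M.powersetCard i).filter fun S => P (insert x S)) = ∅ := by
        refine Finset.filter_eq_empty_iff.2 fun S hS hPS => hN ?_
        obtain ⟨hSM, hSc⟩ := Finset.mem_powersetCard.1 hS
        have h1 := hP (insert x S) (Finset.insert_subset_insert x hSM) M
          (Finset.subset_insert x M) hPS hM ?_
        · rwa [Finset.insert_union, Finset.union_eq_right.2 hSM] at h1
        · have : S ⊆ insert x S ∩ M := fun y hy =>
            Finset.mem_inter.2 ⟨Finset.mem_insert_of_mem hy, hSM hy⟩
          have := Finset.card_le_card this
          omega
      rw [h0, Finset.card_empty, add_zero]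
      refine (Finset.card_filter_le _ _).trans ?_
      rw [Finset.card_powersetCard]
    · have hMpos : M.Nonempty ∨ M = ∅ := M.eq_empty_or_nonempty.symm
      have h1 := ih P t (i + 1) (Or.inr hj)
        (fun A hA B hB => hP A (hA.trans (Finset.subset_insert x M)) B
          (hB.trans (Finset.subset_insert x M))) hM
      have h2 := ih (fun S => P (insert x S)) (t - 1) i (by omega) ?_ hN
      · rcases hMpos with hMpos | rfl
        · obtain ⟨m, hm⟩ := Nat.exists_eq_succ_of_ne_zero hMpos.card_pos.ne'
          rw [hm] at h1 h2 ⊢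
          rw [Nat.choose_succ_succ]
          simp only [Nat.succ_eq_add_one, Nat.add_sub_cancel] at h1 h2 ⊢
          omega
        · rcases Nat.eq_zero_or_pos i with rfl | hi
          · simp only [Finset.powersetCard_zero]
            simp
            have : ¬ P {x} := by simpa using hN
            simp [this]
          · have e1 : (∅ : Finset V).powersetCard i = ∅ := by
              rw [Finset.powersetCard_eq_empty]; simpa using hi
            have e2 : (∅ : Finset V).powersetCard (i + 1) = ∅ := by
              rw [Finset.powersetCard_eq_empty]; simp
            simp [e1, e2]
      · intro A hA B hB hPA hPB hc
        have h3 := hP (insert x A) (Finset.insert_subset_insert x hA) (insert x B)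
          (Finset.insert_subset_insert x hB) hPA hPB ?_
        · rwa [← Finset.insert_union_distrib] at h3
        · rw [← Finset.insert_inter_distrib, Finset.card_insert_of_notMem
            fun h => hx (hA (Finset.mem_inter.1 h).1)]
          omega

end Counting

/-! ### Expected increments -/

section Increments

variable {V : Type u}

theorem half_le_prefixAverage (N : Finset V) {d k : ℕ} (hkd : k ≤ d) (hk : k ≤ N.card) :
    (k : ℝ) / 2 ≤ prefixAverage (fun S => (min S.card d : ℕ)) N := by
  have h1 := prefixAverage_eq_sum_range (fun S : Finset V => ((min S.card d : ℕ) : ℝ)) N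
  have h2 : ∑ j ∈ Finset.range (N.card + 1),
      (∑ S ∈ N.powersetCard j, ((min S.card d : ℕ) : ℝ)) / (N.card.choose j : ℝ) =
      ∑ j ∈ Finset.range (N.card + 1), ((min j d : ℕ) : ℝ) := by
    refine Finset.sum_congr rfl fun j hj => ?_
    rw [Finset.sum_congr rfl fun S hS => by rw [(Finset.mem_powersetCard.1 hS).2],
      Finset.sum_const, Finset.card_powersetCard, nsmul_eq_mul]
    have : (N.card.choose j : ℝ) ≠ 0 := by
      exact_mod_cast (Nat.choose_pos (by simpa [Nat.lt_succ_iff] using hj)).ne'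
    field_simp
  -- pair the term of `j` with the term of `|N| - j`
  have h3 := Finset.sum_range_reflect (fun j => ((min j d : ℕ) : ℝ)) (N.card + 1)
  have h4 : ((N.card + 1 : ℕ) : ℝ) * k ≤ ∑ j ∈ Finset.range (N.card + 1),
      (((min (N.card + 1 - 1 - j) d : ℕ) : ℝ) + ((min j d : ℕ) : ℝ)) := by
    rw [← nsmul_eq_mul]
    nth_rewrite 1 [← Finset.card_range (N.card + 1)]
    refine Finset.card_nsmul_le_sum _ _ _ fun j hj => ?_
    have hj' : j ≤ N.card := by simpa [Nat.lt_succ_iff] using hj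
    have : k ≤ min (N.card + 1 - 1 - j) d + min j d := by omega
    exact_mod_cast this
  rw [Finset.sum_add_distrib, h3, ← h2, ← h1] at h4
  rw [Nat.cast_add, Nat.cast_one] at h4
  have hpos : (0 : ℝ) < N.card + 1 := by positivity
  refine le_of_mul_le_mul_left ?_ hpos
  linarith

theorem sum_range_min (d D : ℕ) (h : d ≤ D) :
    ∑ j ∈ Finset.range (D + 1), ((min j d : ℕ) : ℝ) = d * (D + 1) - d * (d + 1) / 2 := by
  induction D, h using Nat.le_induction with
  | base =>
    have : ∑ j ∈ Finset.range (d + 1), ((min j d : ℕ) : ℝ) = ∑ j ∈ Finset.range (d + 1), (j : ℝ) :=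
      Finset.sum_congr rfl fun j hj => by
        rw [min_eq_left (by simpa [Nat.lt_succ_iff] using hj)]
    have h2 := Finset.sum_range_id_mul_two (d + 1)
    rw [Nat.add_sub_cancel] at h2
    have h3 := congrArg (Nat.cast : ℕ → ℝ) h2
    push_cast at h3
    rw [this]
    linarith
  | succ D h ih =>
    rw [Finset.sum_range_succ, ih, min_eq_right (by omega)]
    push_cast
    ring

theorem sum_range_ite_lt (d D : ℕ) (h : d ≤ D) :
    ∑ j ∈ Finset.range (D + 1), (if d < j then (j : ℝ) else 0) =
      (D * (D + 1) - d * (d + 1)) / 2 := by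
  induction D, h using Nat.le_induction with
  | base =>
    rw [Finset.sum_eq_zero]
    · ring
    · intro j hj
      rw [if_neg]
      simpa [Nat.lt_succ_iff] using hj
  | succ D h ih =>
    rw [Finset.sum_range_succ, ih, if_pos (by omega)]
    push_cast
    ring

open Classical in
/-- The increment in rank that is guaranteed when a vertex with set of neighbours `S` is added to
a closed graph in which `P` singles out the cliques. -/
noncomputable def rankIncrement (d : ℕ) (P : Finset V → Prop) (S : Finset V) : ℕ :=
  min S.card d + if d < S.card ∧ ¬ P S then 1 else 0

theorem le_prefixAverage_rankIncrement [DecidableEq V] (N : Finset V) {d : ℕ} (hd : 1 ≤ d)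
    (hdN : d ≤ N.card) (P : Finset V → Prop)
    (hP : ∀ A ⊆ N, ∀ B ⊆ N, P A → P B → d - 1 ≤ (A ∩ B).card → P (A ∪ B)) (hN : ¬ P N) :
    (d : ℝ) + 1 / 2 - 1 / 2 * ((d : ℝ) * (d + 1) / N.card) ≤
      prefixAverage (fun S => (rankIncrement d P S : ℝ)) N := by
  classical
  have hD : (0 : ℝ) < N.card := by exact_mod_cast (by omega : 0 < N.card)
  have h1 := prefixAverage_eq_sum_range (fun S => (rankIncrement d P S : ℝ)) N
  have h2 : ∑ j ∈ Finset.range (N.card + 1), (((min j d : ℕ) : ℝ) +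
      (if d < j then (j : ℝ) else 0) / N.card) ≤ ∑ j ∈ Finset.range (N.card + 1),
      (∑ S ∈ N.powersetCard j, (rankIncrement d P S : ℝ)) / (N.card.choose j : ℝ) := by
    refine Finset.sum_le_sum fun j hj => ?_
    have hj' : j ≤ N.card := by simpa [Nat.lt_succ_iff] using hj
    have hc : (0 : ℝ) < N.card.choose j := by exact_mod_cast Nat.choose_pos hj'
    have e1 : ∑ S ∈ N.powersetCard j, (rankIncrement d P S : ℝ) = N.card.choose j * (min j d : ℕ) +
        ∑ S ∈ N.powersetCard j, if d < j ∧ ¬ P S then (1 : ℝ) else 0 := by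
      rw [← Finset.card_powersetCard, ← nsmul_eq_mul, ← Finset.sum_const, ← Finset.sum_add_distrib]
      refine Finset.sum_congr rfl fun S hS => ?_
      rw [rankIncrement, (Finset.mem_powersetCard.1 hS).2]
      push_cast
      rfl
    rw [e1, le_div_iff₀ hc, add_mul, mul_comm]
    refine add_le_add le_rfl ?_
    by_cases hdj : d < j
    · simp only [hdj, true_and, if_true]
      have e2 := card_filter_powersetCard_le N P (d - 1) j (Or.inr (by omega)) hP hN
      have e3 := Finset.card_filter_add_card_filter_not (s := N.powersetCard j) P
      rw [Finset.card_powersetCard] at e3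
      obtain ⟨D, hDe⟩ : ∃ D, N.card = D + 1 := ⟨N.card - 1, by omega⟩
      obtain ⟨i, rfl⟩ : ∃ i, j = i + 1 := ⟨j - 1, by omega⟩
      rw [← Finset.sum_filter, Finset.sum_const, nsmul_eq_mul, mul_one]
      rw [hDe] at e2 e3 ⊢
      rw [Nat.add_sub_cancel] at e2
      have e4 : D.choose i ≤ ((N.powersetCard (i + 1)).filter fun S => ¬ P S).card := by
        have := Nat.choose_succ_succ D i
        simp only [Nat.succ_eq_add_one] at this
        omega
      have e5 := Nat.add_one_mul_choose_eq D i
      have e5' : ((D + 1 : ℕ) : ℝ) * (D.choose i : ℝ) =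
        ((D + 1).choose (i + 1) : ℝ) * ((i + 1 : ℕ) : ℝ) := by exact_mod_cast e5
      have e6 : ((i + 1 : ℕ) : ℝ) / ((D + 1 : ℕ) : ℝ) * ((D + 1).choose (i + 1) : ℝ) =
          (D.choose i : ℝ) := by
        rw [div_mul_eq_mul_div, mul_comm, ← e5']
        field_simp
      rw [e6]
      exact_mod_cast e4
    · simp [hdj]
  rw [← h1, Finset.sum_add_distrib, ← Finset.sum_div, sum_range_min d _ hdN,
    sum_range_ite_lt d _ hdN] at h2
  have hpos : (0 : ℝ) < N.card + 1 := by positivity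
  refine le_of_mul_le_mul_left (le_trans (le_of_eq ?_) h2) hpos
  field_simp
  ring

end Increments

/-! ### Lower bound for the rank -/

section LowerBound

variable {V : Type u} {d : ℕ}

/-- The edges of `G` with both ends in `A`. -/
def edgesWithin (G : SimpleGraph V) (A : Finset V) : Set (Sym2 V) :=
  {e | e ∈ G.edgeSet ∧ ∀ x ∈ e, x ∈ A}

/-- `G` is closed in the rigidity matroid of the framework `p` of the complete graph. -/
def IsClosedIn (p : V → EuclideanSpace ℝ (Fin d)) (G : SimpleGraph V) : Prop :=
  ∀ u w, u ≠ w → rigidityRow p s(u, w) ∈ rowSpan p G.edgeSet → G.Adj u w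

/-- The subgraph of `G` induced by `A` has no separation of order less than `k`. -/
def HasNoSmallSeparation [DecidableEq V] (k : ℕ) (G : SimpleGraph V) (A : Finset V) : Prop :=
  ∀ X ⊆ A, ∀ Y ⊆ A, X.Nonempty → Y.Nonempty → Disjoint X Y →
    (∀ x ∈ X, ∀ y ∈ Y, ¬ G.Adj x y) → k ≤ (A \ (X ∪ Y)).card

theorem IsClosedIn.isClique_union [DecidableEq V] {p : V → EuclideanSpace ℝ (Fin d)}
    (hp : IsGeneric p) {G : SimpleGraph V} (hG : IsClosedIn p G) {A B : Finset V}
    (hA : G.IsClique (A : Set V)) (hB : G.IsClique (B : Set V)) (hAB : d ≤ (A ∩ B).card) :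
    G.IsClique ((A ∪ B : Finset V) : Set V) := by
  have key : ∀ A B : Finset V, G.IsClique (A : Set V) → G.IsClique (B : Set V) →
      d ≤ (A ∩ B).card → ∀ a ∈ A, ∀ b ∈ B, a ≠ b → G.Adj a b := by
    intro A B hA hB hAB a ha b hb hab
    by_cases haB : a ∈ B
    · exact hB haB hb hab
    by_cases hbA : b ∈ A
    · exact hA ha hbA hab
    obtain ⟨T, hT, hTc⟩ := Finset.exists_subset_card_eq hAB
    have hTA : ∀ t ∈ T, t ∈ A := fun t ht => (Finset.mem_inter.1 (hT ht)).1
    have hTB : ∀ t ∈ T, t ∈ B := fun t ht => (Finset.mem_inter.1 (hT ht)).2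
    refine hG a b hab (hp.rigidityRow_mem_of_card_eq _ hTc (fun h => haB (hTB a h))
      (fun h => hbA (hTA b h)) ?_ ?_ ?_)
    · intro s hs t ht hst
      exact rigidityRow_mem_rowSpan p (hA (hTA s hs) (hTA t ht) hst)
    · intro t ht
      exact rigidityRow_mem_rowSpan p (hA ha (hTA t ht) fun h => haB (h ▸ hTB t ht))
    · intro t ht
      exact rigidityRow_mem_rowSpan p (hB hb (hTB t ht) fun h => hbA (h ▸ hTA t ht))
  intro a ha b hb hab
  rw [Finset.mem_coe, Finset.mem_union] at ha hb
  rcases ha with ha | ha <;> rcases hb with hb | hb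
  · exact hA ha hb hab
  · exact key A B hA hB hAB a ha b hb hab
  · exact (key A B hA hB hAB b hb a ha hab.symm).symm
  · exact hB ha hb hab

variable [Fintype V]

theorem edgesWithin_univ (G : SimpleGraph V) : edgesWithin G Finset.univ = G.edgeSet := by
  simp [edgesWithin]

variable [DecidableEq V]

theorem rowRank_edgesWithin_erase_add_min_le {p : V → EuclideanSpace ℝ (Fin d)} (hp : IsGeneric p)
    (G : SimpleGraph V) [DecidableRel G.Adj] {A : Finset V} {v : V} (hv : v ∈ A) :
    rowRank p (edgesWithin G (A.erase v)) + min (G.neighborFinset v ∩ A).card d ≤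
      rowRank p (edgesWithin G A) := by
  obtain ⟨T, hT, hTc⟩ := Finset.exists_subset_card_eq
    (min_le_left (G.neighborFinset v ∩ A).card d)
  have hvT : v ∉ T := fun h => by simpa using hT h
  rw [← hTc]
  refine rowRank_add_card_le hvT (hp.linearIndependent_sub hvT (by omega)) ?_ ?_ ?_
  · intro e he hve
    simpa using he.2 v hve
  · exact rowSpan_mono p fun e he => ⟨he.1, fun x hx => Finset.mem_of_mem_erase (he.2 x hx)⟩
  · intro t ht
    have h1 := hT ht
    simp only [Finset.mem_inter, SimpleGraph.mem_neighborFinset] at h1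
    refine ⟨h1.1, fun x hx => ?_⟩
    rcases Sym2.mem_iff.1 hx with rfl | rfl
    · exact hv
    · exact h1.2

theorem rowRank_edgesWithin_erase_add_rankIncrement_le {p : V → EuclideanSpace ℝ (Fin d)}
    (hp : IsGeneric p) (hd : 1 ≤ d) {G : SimpleGraph V} [DecidableRel G.Adj] (hG : IsClosedIn p G)
    {A : Finset V} {v : V} (hv : v ∈ A) :
    rowRank p (edgesWithin G (A.erase v)) +
        rankIncrement d (fun S : Finset V => G.IsClique (S : Set V)) (G.neighborFinset v ∩ A) ≤
      rowRank p (edgesWithin G A) := by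
  rw [rankIncrement]
  split_ifs with h
  · obtain ⟨hdN, hcl⟩ := h
    rw [SimpleGraph.isClique_iff, Set.Pairwise] at hcl
    push Not at hcl
    obtain ⟨u, hu, w, hw, hne, huw⟩ := hcl
    rw [min_eq_right hdN.le]
    refine hp.rowRank_add_succ_le hd (v := v) (by simp) hdN ?_ ?_ ?_ hu hw ?_
    · intro e he hve
      simpa using he.2 v hve
    · exact fun e he => ⟨he.1, fun x hx => Finset.mem_of_mem_erase (he.2 x hx)⟩
    · intro t ht
      simp only [Finset.mem_inter, SimpleGraph.mem_neighborFinset] at ht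
      refine ⟨ht.1, fun x hx => ?_⟩
      rcases Sym2.mem_iff.1 hx with rfl | rfl
      · exact hv
      · exact ht.2
    · exact fun h => huw (hG u w hne (rowSpan_mono p (fun e he => he.1) h))
  · exact rowRank_edgesWithin_erase_add_min_le hp G hv

theorem HasNoSmallSeparation.le_card_neighborFinset_inter {k : ℕ} {G : SimpleGraph V}
    [DecidableRel G.Adj] {A : Finset V} (h : HasNoSmallSeparation k G A) (hA : k < A.card) {v : V}
    (hv : v ∈ A) : k ≤ (G.neighborFinset v ∩ A).card := by
  have hsub : G.neighborFinset v ∩ A ⊆ A.erase v := by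
    intro x hx
    simp only [Finset.mem_inter, SimpleGraph.mem_neighborFinset] at hx
    exact Finset.mem_erase.2 ⟨hx.1.ne', hx.2⟩
  rcases (A.erase v \ (G.neighborFinset v ∩ A)).eq_empty_or_nonempty with h0 | h0
  · have := Finset.card_le_card (Finset.sdiff_eq_empty_iff_subset.1 h0)
    rw [Finset.card_erase_of_mem hv] at this
    omega
  · refine (h {v} (by simpa using hv) _ (Finset.sdiff_subset.trans (Finset.erase_subset v A))
      (by simp) h0 (by simp) ?_).trans (Finset.card_le_card ?_)
    · intro x hx y hy hxy
      rw [Finset.mem_singleton] at hx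
      subst hx
      simp only [Finset.mem_sdiff, Finset.mem_inter, SimpleGraph.mem_neighborFinset,
        Finset.mem_erase] at hy
      exact hy.2 ⟨hxy, hy.1.2⟩
    · intro x hx
      simp only [Finset.mem_sdiff, Finset.mem_union, Finset.mem_singleton, Finset.mem_erase] at hx
      by_contra hx'
      exact hx.2 (by tauto)

/-- The random ordering argument when `k ≤ d`. -/
theorem half_mul_card_le_rowRank {p : V → EuclideanSpace ℝ (Fin d)} (hp : IsGeneric p)
    {G : SimpleGraph V} {k : ℕ} (hkd : k ≤ d) (h : HasNoSmallSeparation k G Finset.univ)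
    (hk : k < Fintype.card V) : (k : ℝ) / 2 * Fintype.card V ≤ rowRank p G.edgeSet := by
  classical
  have h1 := sum_prefixAverage_le (fun A => (rowRank p (edgesWithin G A) : ℝ)) (by simp)
    (fun _ S => (min S.card d : ℕ)) (fun v => G.neighborFinset v) (by simp)
    (fun A v hv => by exact_mod_cast rowRank_edgesWithin_erase_add_min_le hp G hv) Finset.univ
  simp only [edgesWithin_univ] at h1
  refine le_trans ?_ h1
  rw [mul_comm, ← nsmul_eq_mul]
  refine Finset.card_nsmul_le_sum _ _ _ fun v hv => half_le_prefixAverage _ hkd ?_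
  exact h.le_card_neighborFinset_inter hk hv

/-- The lower bound on the rank of a closed graph for `k > d`. Vertices whose neighbourhood is a
clique are removed one by one, as they contribute `d` each; when there are none left, the vertices
are added in a random order. -/
theorem IsClosedIn.mul_card_le_rowRank {p : V → EuclideanSpace ℝ (Fin d)} (hp : IsGeneric p)
    (hd : 1 ≤ d) {G : SimpleGraph V} (hG : IsClosedIn p G) {k : ℕ} (hdk : d < k)
    (hkd : k < d * (d + 1)) (A : Finset V) (hA : HasNoSmallSeparation k G A)
    (hAc : ¬ G.IsClique (A : Set V)) :
    ((d : ℝ) + 1 / 2 - 1 / 2 * ((d : ℝ) * (d + 1) / k)) * A.card ≤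
      rowRank p (edgesWithin G A) := by
  classical
  have hk0 : (0 : ℝ) < k := by exact_mod_cast (by omega : 0 < k)
  have hmd : (d : ℝ) + 1 / 2 - 1 / 2 * ((d : ℝ) * (d + 1) / k) ≤ d := by
    have h1 : (1 : ℝ) ≤ (d : ℝ) * (d + 1) / k := by
      rw [le_div_iff₀ hk0, one_mul]
      exact_mod_cast hkd.le
    linarith
  induction A using Finset.strongInduction with
  | H A ih =>
    have hkA : k < A.card := by
      rw [SimpleGraph.isClique_iff, Set.Pairwise] at hAc
      push Not at hAc
      obtain ⟨u, hu, w, hw, hne, huw⟩ := hAc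
      have h1 := hA {u} (by simpa using hu) {w} (by simpa using hw) (by simp) (by simp)
        (by simpa using hne) (by simpa using huw)
      have h2 : A \ ({u} ∪ {w}) ⊂ A := by
        refine (Finset.ssubset_iff_of_subset Finset.sdiff_subset).2 ⟨u, hu, by simp⟩
      have := Finset.card_lt_card h2
      omega
    -- a vertex whose neighbourhood is a clique: the separation property survives its removal,
    -- and a complete remainder would merge with its closed neighbourhood
    by_cases hs : ∃ v ∈ A, G.IsClique ((G.neighborFinset v ∩ A : Finset V) : Set V)
    · obtain ⟨v, hv, hvc⟩ := hs
      have hdeg := hA.le_card_neighborFinset_inter hkA hv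
      have hsep : HasNoSmallSeparation k G (A.erase v) := by
        have key : ∀ X ⊆ A.erase v, ∀ Y ⊆ A.erase v, X.Nonempty → Y.Nonempty → Disjoint X Y →
            (∀ x ∈ X, ∀ y ∈ Y, ¬ G.Adj x y) → (∀ y ∈ Y, ¬ G.Adj v y) →
            k ≤ (A.erase v \ (X ∪ Y)).card := by
          intro X hX Y hY hXn hYn hXY hadj hvY
          have h1 := hA (insert v X)
            (Finset.insert_subset hv (hX.trans (Finset.erase_subset v A))) Y
            (hY.trans (Finset.erase_subset v A)) (Finset.insert_nonempty v X) hYn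
            (Finset.disjoint_insert_left.2 ⟨fun h => by simpa using hY h, hXY⟩) ?_
          · convert h1 using 2
            ext x
            simp only [Finset.mem_sdiff, Finset.mem_erase, Finset.mem_union, Finset.mem_insert]
            tauto
          · intro x hx y hy
            rcases Finset.mem_insert.1 hx with rfl | hx
            · exact hvY y hy
            · exact hadj x hx y hy
        intro X hX Y hY hXn hYn hXY hadj
        by_cases hvY : ∀ y ∈ Y, ¬ G.Adj v y
        · exact key X hX Y hY hXn hYn hXY hadj hvY
        · push Not at hvY
          obtain ⟨y, hy, hvy⟩ := hvY
          rw [Finset.union_comm]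
          refine key Y hY X hX hYn hXn hXY.symm (fun y hy x hx h => hadj x hx y hy h.symm) ?_
          intro x hx hvx
          refine hadj x hx y hy (hvc ?_ ?_ ?_)
          · simpa [hvx] using Finset.mem_of_mem_erase (hX hx)
          · simpa [hvy] using Finset.mem_of_mem_erase (hY hy)
          · rintro rfl
            exact (Finset.disjoint_left.1 hXY hx) hy
      have hcl : ¬ G.IsClique ((A.erase v : Finset V) : Set V) := by
        intro hcl
        have hv' : G.IsClique ((insert v (G.neighborFinset v ∩ A) : Finset V) : Set V) := by
          rw [Finset.coe_insert, SimpleGraph.isClique_insert]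
          exact ⟨hvc, fun b hb _ => by simpa using (Finset.mem_inter.1 hb).1⟩
        have h1 := hG.isClique_union hp hv' hcl ?_
        · refine hAc (h1.subset ?_)
          intro x hx
          by_cases hxv : x = v
          · simp [hxv]
          · have : x ∈ A := hx
            simp [hxv, this]
        · refine (hdk.le.trans hdeg).trans (Finset.card_le_card ?_)
          intro x hx
          have hx' := hx
          simp only [Finset.mem_inter, SimpleGraph.mem_neighborFinset] at hx'
          exact Finset.mem_inter.2 ⟨Finset.mem_insert_of_mem hx,
            Finset.mem_erase.2 ⟨hx'.1.ne', hx'.2⟩⟩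
      have h1 := ih _ (Finset.erase_ssubset hv) hsep hcl
      have h2 := rowRank_edgesWithin_erase_add_min_le hp G hv
      rw [min_eq_right (by omega)] at h2
      have h2' : (rowRank p (edgesWithin G (A.erase v)) : ℝ) + d ≤ rowRank p (edgesWithin G A) := by
        exact_mod_cast h2
      rw [Finset.card_erase_of_mem hv, Nat.cast_sub (by omega)] at h1
      push_cast at h1
      linarith
    · push Not at hs
      have h1 := sum_prefixAverage_le (fun A => (rowRank p (edgesWithin G A) : ℝ)) (by simp)
        (fun _ S => (rankIncrement d (fun S : Finset V => G.IsClique (S : Set V)) S : ℝ))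
        (fun v => G.neighborFinset v) (by simp)
        (fun A v hv => by
          exact_mod_cast rowRank_edgesWithin_erase_add_rankIncrement_le hp hd hG hv) A
      refine le_trans ?_ h1
      rw [mul_comm, ← nsmul_eq_mul]
      refine Finset.card_nsmul_le_sum _ _ _ fun v hv => ?_
      have hdeg := hA.le_card_neighborFinset_inter hkA hv
      refine le_trans ?_ (le_prefixAverage_rankIncrement (G.neighborFinset v ∩ A) hd (by omega)
        (fun S : Finset V => G.IsClique (S : Set V)) ?_ (hs v hv))
      · gcongr
      · intro S hS T hT hSc hTc hST
        have hvN : ∀ S ⊆ G.neighborFinset v ∩ A, G.IsClique (S : Set V) →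
            v ∉ S ∧ G.IsClique ((insert v S : Finset V) : Set V) := by
          intro S hS hSc
          refine ⟨fun h => by simpa using hS h, ?_⟩
          rw [Finset.coe_insert, SimpleGraph.isClique_insert]
          exact ⟨hSc, fun b hb _ => by simpa using (Finset.mem_inter.1 (hS hb)).1⟩
        have h2 := hG.isClique_union hp (hvN S hS hSc).2 (hvN T hT hTc).2 ?_
        · refine h2.subset ?_
          intro x hx
          have : x ∈ S ∪ T := hx
          rw [Finset.mem_union] at this
          simp only [Finset.coe_union, Finset.coe_insert, Set.mem_union, Set.mem_insert_iff,
            Finset.mem_coe]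
          tauto
        · rw [← Finset.insert_inter_distrib, Finset.card_insert_of_notMem
            fun h => (hvN S hS hSc).1 (Finset.mem_inter.1 h).1]
          omega

end LowerBound

/-! ### Rigidity and the rank of the rigidity matrix -/

section Rigidity

variable {V : Type u} {d : ℕ}

theorem rigidityRank_eq_rowRank [Fintype V] (G : SimpleGraph V)
    {p : V → EuclideanSpace ℝ (Fin d)} (hp : IsGeneric p) :
    rigidityRank d G = rowRank p G.edgeSet := by
  rw [rigidityRank_eq_rank G hp, Matrix.rank_eq_finrank_span_row, rowRank, rowSpan,
    Set.image_eq_range]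
  rfl

/-- The pairing of a row vector with an infinitesimal motion. -/
noncomputable def motionPairing [Fintype V] (x : V → EuclideanSpace ℝ (Fin d)) :
    (V × Fin d → ℝ) →ₗ[ℝ] ℝ where
  toFun f := ∑ y : V × Fin d, f y * x y.1 y.2
  map_add' f g := by simp [add_mul, Finset.sum_add_distrib]
  map_smul' c f := by simp [mul_assoc, Finset.mul_sum]

theorem motionPairing_rigidityRow [Fintype V] (x p : V → EuclideanSpace ℝ (Fin d)) (u v : V) :
    motionPairing x (rigidityRow p s(u, v)) = inner ℝ (p u - p v) (x u - x v) := by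
  classical
  simp only [motionPairing, LinearMap.coe_mk, AddHom.coe_mk, rigidityRow, Sym2.lift_mk, add_mul,
    Finset.sum_add_distrib, ite_mul, zero_mul, Fintype.sum_prod_type, PiLp.inner_apply,
    RCLike.inner_apply, conj_trivial, PiLp.sub_apply]
  rw [Finset.sum_eq_single u (fun b _ hb => by simp [hb]) (by simp),
    Finset.sum_eq_single v (fun b _ hb => by simp [hb]) (by simp), ← Finset.sum_add_distrib]
  refine Finset.sum_congr rfl fun i _ => ?_
  simp only [if_true]
  ring

/-- Near a generic framework the rows of the edges of `G` keep spanning every row that they span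
at the framework itself, because the rank cannot rise and does not drop. -/
theorem IsGeneric.eventually_rowSpan_le [Finite V] {p : V → EuclideanSpace ℝ (Fin d)}
    (hp : IsGeneric p) {I F : Set (Sym2 V)} (hI : LinearIndepOn ℝ (rigidityRow p) I)
    (hIF : I ⊆ F) (hF : rowSpan p F ≤ rowSpan p I) :
    ∀ᶠ q in nhds p, rowSpan q F ≤ rowSpan q I ∧ LinearIndepOn ℝ (rigidityRow q) I := by
  classical
  cases nonempty_fintype V
  have hcont : Continuous fun (q : V → EuclideanSpace ℝ (Fin d)) (e : I) =>
      rigidityRow q (e : Sym2 V) := by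
    refine continuous_pi fun ⟨e, _⟩ => continuous_pi fun x => ?_
    induction e using Sym2.ind with
    | h a b =>
      simp only [rigidityRow, Sym2.lift_mk]
      refine Continuous.add ?_ ?_ <;> split_ifs <;> fun_prop
  have hopen := (isOpen_setOfPred_linearIndependent (𝕜 := ℝ) (E := V × Fin d → ℝ)
    (ι := I)).preimage hcont
  filter_upwards [hopen.mem_nhds hI] with q hq
  have hq' : LinearIndepOn ℝ (rigidityRow q) I := hq
  refine ⟨?_, hq'⟩
  have h1 : rowRank q F ≤ rowRank q I := by
    calc rowRank q F ≤ rowRank p F := hp.rowRank_le q F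
      _ ≤ rowRank p I := Submodule.finrank_mono hF
      _ = rowRank q I := by rw [rowRank_eq_ncard hI, rowRank_eq_ncard hq']
  exact (Submodule.eq_of_le_of_finrank_le (rowSpan_mono q hIF) h1).ge

/-- Infinitesimal rigidity implies rigidity: if `q` is equivalent to `p`, then `q - p` is an
infinitesimal motion of the framework `(p + q) / 2`, which is infinitesimally rigid as well if `q`
is close to `p`. -/
theorem IsGeneric.frameworkRigid [Finite V] {p : V → EuclideanSpace ℝ (Fin d)}
    (hp : IsGeneric p) (G : SimpleGraph V)
    (h : ∀ u v, u ≠ v → rigidityRow p s(u, v) ∈ rowSpan p G.edgeSet) : FrameworkRigid G p := by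
  classical
  cases nonempty_fintype V
  obtain ⟨I, hIG, hI, hspan⟩ := exists_subset_rowSpan_eq p G.edgeSet
  have hall : rowSpan p Set.univ ≤ rowSpan p I := by
    rw [hspan, rowSpan_le_iff]
    intro e _
    induction e using Sym2.ind with
    | h a b =>
      by_cases hab : a = b
      · subst hab
        rw [rigidityRow_diag]
        exact zero_mem _
      · exact h a b hab
  obtain ⟨ε, hε, hball⟩ := Metric.eventually_nhds_iff.1
    (hp.eventually_rowSpan_le hI (Set.subset_univ I) hall)
  refine ⟨ε, hε, fun q hq hlt u v => ?_⟩
  set m : V → EuclideanSpace ℝ (Fin d) := (2⁻¹ : ℝ) • (p + q) with hm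
  have hmp : dist m p < ε := by
    rw [dist_pi_lt_iff hε]
    intro x
    have e : m x - p x = (-2⁻¹ : ℝ) • (p x - q x) := by
      simp only [hm, Pi.smul_apply, Pi.add_apply]
      module
    rw [dist_eq_norm, e, norm_smul]
    have := hlt x
    have h0 := norm_nonneg (p x - q x)
    norm_num
    linarith
  have hpair : ∀ a b, motionPairing (q - p) (rigidityRow m s(a, b)) =
      2⁻¹ * (‖q a - q b‖ ^ 2 - ‖p a - p b‖ ^ 2) := by
    intro a b
    rw [motionPairing_rigidityRow]
    have e1 : m a - m b = (2⁻¹ : ℝ) • ((q a - q b) + (p a - p b)) := by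
      simp only [hm, Pi.smul_apply, Pi.add_apply]
      module
    have e2 : (q - p) a - (q - p) b = (q a - q b) - (p a - p b) := by
      simp only [Pi.sub_apply]
      module
    rw [e1, e2]
    generalize q a - q b = x
    generalize p a - p b = y
    rw [inner_smul_left, inner_add_left, inner_sub_right, inner_sub_right,
      real_inner_self_eq_norm_sq, real_inner_self_eq_norm_sq, real_inner_comm x y]
    simp
  have hker : rowSpan m I ≤ LinearMap.ker (motionPairing (q - p)) := by
    rw [rowSpan_le_iff]
    intro e he
    induction e using Sym2.ind with
    | h a b =>
      rw [LinearMap.mem_ker, hpair, hq a b (hIG he)]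
      ring
  have huv := hker ((hball hmp).1 (rigidityRow_mem_rowSpan m (Set.mem_univ s(u, v))))
  rw [LinearMap.mem_ker, hpair] at huv
  have h2 : ‖p u - p v‖ ^ 2 = ‖q u - q v‖ ^ 2 := by linarith
  exact (sq_eq_sq₀ (norm_nonneg _) (norm_nonneg _)).1 h2

/-- Half the squared length of a pair. -/
noncomputable def halfSqLength (q : V → EuclideanSpace ℝ (Fin d)) : Sym2 V → ℝ :=
  Sym2.lift ⟨fun u v => 2⁻¹ * ‖q u - q v‖ ^ 2, fun u v => by simp only [norm_sub_rev]⟩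

theorem contDiff_halfSqLength [Fintype V] (e : Sym2 V) :
    ContDiff ℝ 1 fun q : V → EuclideanSpace ℝ (Fin d) => halfSqLength q e := by
  induction e using Sym2.ind with
  | h a b =>
    simp only [halfSqLength, Sym2.lift_mk]
    have h1 : ContDiff ℝ 1 fun q : V → EuclideanSpace ℝ (Fin d) => q a - q b := by fun_prop
    exact contDiff_const.mul (h1.norm_sq ℝ)

theorem hasDerivAt_halfSqLength [Fintype V] {γ : ℝ → V → EuclideanSpace ℝ (Fin d)} {t : ℝ}
    {γ' : V → EuclideanSpace ℝ (Fin d)} (h : HasDerivAt γ γ' t) (e : Sym2 V) :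
    HasDerivAt (fun s => halfSqLength (γ s) e) (motionPairing γ' (rigidityRow (γ t) e)) t := by
  induction e using Sym2.ind with
  | h a b =>
    rw [motionPairing_rigidityRow]
    simp only [halfSqLength, Sym2.lift_mk]
    have h1 : HasDerivAt (fun s => γ s a - γ s b) (γ' a - γ' b) t :=
      ((hasDerivAt_pi.1 h) a).sub ((hasDerivAt_pi.1 h) b)
    have h2 := (h1.norm_sq).const_mul (2⁻¹ : ℝ)
    refine h2.congr_deriv ?_
    rw [← mul_assoc, inv_mul_cancel₀ two_ne_zero, one_mul]

theorem exists_motionPairing_eq [Fintype V] (f : Module.Dual ℝ (V × Fin d → ℝ)) :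
    ∃ x : V → EuclideanSpace ℝ (Fin d), motionPairing x = f := by
  classical
  refine ⟨fun v => WithLp.toLp 2 fun i => f (Pi.single (v, i) 1), ?_⟩
  refine (Pi.basisFun ℝ (V × Fin d)).ext fun y => ?_
  simp only [motionPairing, LinearMap.coe_mk, AddHom.coe_mk, Pi.basisFun_apply, Pi.single_apply,
    ite_mul, one_mul, zero_mul, Finset.sum_ite_eq', Finset.mem_univ, if_true]

/-- A generic framework with a nontrivial infinitesimal motion `x` is flexible. The lengths of a
maximal independent set `I` of edges are kept along the curve `γ` whose image under a local
diffeomorphism `Φ` is a line in the direction `x`. The lengths of the other edges are kept too, as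
their rows stay in the span of the rows of `I`. -/
theorem IsGeneric.not_frameworkRigid [Finite V] {p : V → EuclideanSpace ℝ (Fin d)}
    (hp : IsGeneric p) (G : SimpleGraph V) {u v : V}
    (h : rigidityRow p s(u, v) ∉ rowSpan p G.edgeSet) : ¬ FrameworkRigid G p := by
  classical
  cases nonempty_fintype V
  obtain ⟨I, hIG, hI, hspan⟩ := exists_subset_rowSpan_eq p G.edgeSet
  obtain ⟨f, hf, hker⟩ := Submodule.exists_le_ker_of_notMem h
  obtain ⟨x, rfl⟩ := exists_motionPairing_eq f
  -- the length map of `I`, its derivative at `p`, and a right inverse of the derivative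
  let Fm : (V → EuclideanSpace ℝ (Fin d)) → (I → ℝ) := fun q e => halfSqLength q e
  let L : (V → EuclideanSpace ℝ (Fin d)) →ₗ[ℝ] (I → ℝ) :=
    { toFun := fun y e => motionPairing y (rigidityRow p e)
      map_add' := fun y z => by
        funext e
        simp [motionPairing, mul_add, Finset.sum_add_distrib]
      map_smul' := fun c y => by
        funext e
        simp only [motionPairing, Pi.smul_apply, LinearMap.coe_mk, AddHom.coe_mk,
          PiLp.smul_apply, smul_eq_mul, RingHom.id_apply, Finset.mul_sum]
        exact Finset.sum_congr rfl fun _ _ => by ring }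
  have hL : LinearMap.range L = ⊤ := by
    rw [LinearMap.range_eq_top]
    intro z
    have hI' : LinearIndependent ℝ fun e : I => rigidityRow p e := hI
    obtain ⟨g, hg⟩ := LinearMap.exists_extend ((Module.Basis.span hI').constr ℝ z)
    obtain ⟨y, rfl⟩ := exists_motionPairing_eq g
    refine ⟨y, funext fun e => ?_⟩
    have h1 := LinearMap.congr_fun hg (Module.Basis.span hI' e)
    rw [Module.Basis.constr_basis] at h1
    rw [← h1, LinearMap.comp_apply, Submodule.subtype_apply, Module.Basis.span_apply]
    rfl
  obtain ⟨s, hs⟩ := LinearMap.exists_rightInverse_of_surjective L hL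
  have hs' : ∀ z, L (s z) = z := fun z => LinearMap.congr_fun hs z
  let Lc := LinearMap.toContinuousLinearMap L
  let sc := LinearMap.toContinuousLinearMap s
  have hFd : ContDiff ℝ 1 Fm := contDiff_pi.2 fun e => contDiff_halfSqLength (e : Sym2 V)
  have hFderiv : HasFDerivAt Fm Lc p := by
    have h1 : HasFDerivAt Fm (fderiv ℝ Fm p) p :=
      (hFd.differentiable one_ne_zero p).hasFDerivAt
    have h2 : fderiv ℝ Fm p = Lc := by
      ext y e
      have h3 : HasDerivAt (fun t : ℝ => p + t • y) y 0 := by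
        simpa using ((hasDerivAt_id (0 : ℝ)).smul_const y).const_add p
      have h4 := hasDerivAt_halfSqLength h3 (e : Sym2 V)
      have h5 : HasFDerivAt Fm (fderiv ℝ Fm p) (p + (0 : ℝ) • y) := by simpa using h1
      have h6 := (hasDerivAt_pi.1 (h5.comp_hasDerivAt (0 : ℝ) h3)) e
      have h7 := h6.unique h4
      simpa [Lc, L] using h7
    rwa [h2] at h1
  -- `L ∘ Φ = Fm`, and the derivative of `Φ` at `p` is the identity since `L ∘ s = id`
  let Φ : (V → EuclideanSpace ℝ (Fin d)) → (V → EuclideanSpace ℝ (Fin d)) :=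
    fun q => sc (Fm q) + (q - sc (Lc q))
  have hΦd : ContDiff ℝ 1 Φ := by
    have := sc.contDiff (n := 1)
    have := Lc.contDiff (n := 1)
    fun_prop
  have hΦderiv : HasFDerivAt Φ
      ((ContinuousLinearEquiv.refl ℝ (V → EuclideanSpace ℝ (Fin d)) :
        (V → EuclideanSpace ℝ (Fin d)) ≃L[ℝ] (V → EuclideanSpace ℝ (Fin d))) :
        (V → EuclideanSpace ℝ (Fin d)) →L[ℝ] (V → EuclideanSpace ℝ (Fin d))) p := by
    have h1 := (sc.hasFDerivAt.comp p hFderiv).add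
      ((hasFDerivAt_id p).sub ((sc.comp Lc).hasFDerivAt (x := p)))
    refine HasFDerivAt.congr_fderiv (f := Φ) h1 ?_
    ext1 y
    simp
  have hLΦ : ∀ q, L (Φ q) = Fm q := by
    intro q
    have : Φ q = s (Fm q) + (q - s (L q)) := rfl
    rw [this, map_add, map_sub, hs', hs']
    abel
  have hΦat : ContDiffAt ℝ 1 Φ p := hΦd.contDiffAt
  let Ψ := hΦat.localInverse hΦderiv one_ne_zero
  have hΨd : ContDiffAt ℝ 1 Ψ (Φ p) := hΦat.to_localInverse hΦderiv one_ne_zero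
  have hΨp : Ψ (Φ p) = p := hΦat.localInverse_apply_image hΦderiv one_ne_zero
  have hΨr : ∀ᶠ y in nhds (Φ p), Φ (Ψ y) = y :=
    (hΦat.hasStrictFDerivAt' hΦderiv one_ne_zero).eventually_right_inverse
  let ℓ : ℝ → V → EuclideanSpace ℝ (Fin d) := fun t => Φ p + t • x
  have hℓ : ∀ t, HasDerivAt ℓ x t := fun t => by
    have h1 := ((hasDerivAt_id t).smul_const x).const_add (Φ p)
    rw [one_smul] at h1
    exact h1
  have hℓc : Continuous ℓ := by fun_prop
  have hℓ0 : ℓ 0 = Φ p := by simp [ℓ]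
  let γ : ℝ → V → EuclideanSpace ℝ (Fin d) := fun t => Ψ (ℓ t)
  have hγ0 : γ 0 = p := by simp [γ, hℓ0, hΨp]
  have hγΦ : ∀ᶠ t in nhds (0 : ℝ), Φ (γ t) = ℓ t :=
    hℓc.continuousAt.eventually (by rw [hℓ0]; exact hΨr)
  have hγd : ∀ᶠ t in nhds (0 : ℝ), DifferentiableAt ℝ γ t := by
    have h1 : ∀ᶠ y in nhds (Φ p), ContDiffAt ℝ 1 Ψ y := hΨd.eventually (by simp)
    have h2 := (hℓc.continuousAt (x := 0)).eventually (by rw [hℓ0]; exact h1)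
    filter_upwards [h2] with t ht
    exact (ht.differentiableAt one_ne_zero).comp t (hℓ t).differentiableAt
  have hγc : ContinuousAt γ 0 := hγd.self_of_nhds.continuousAt
  have hγ0' : deriv γ 0 = x := by
    have h1 : HasDerivAt γ (deriv γ 0) 0 := hγd.self_of_nhds.hasDerivAt
    have h2 : HasFDerivAt Φ (ContinuousLinearMap.id ℝ (V → EuclideanSpace ℝ (Fin d))) (γ 0) := by
      rw [hγ0]; exact hΦderiv
    have h3 := h2.comp_hasDerivAt (0 : ℝ) h1
    have h4 : HasDerivAt ℓ (deriv γ 0) 0 :=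
      h3.congr_of_eventuallyEq (hγΦ.mono fun t ht => ht.symm)
    exact h4.unique (hℓ 0)
  have hLx : L x = 0 := by
    funext e
    exact hker (rigidityRow_mem_rowSpan p (hIG e.2))
  have hFγ : ∀ᶠ t in nhds (0 : ℝ), ∀ e ∈ I, halfSqLength (γ t) e = halfSqLength p e := by
    filter_upwards [hγΦ] with t ht e he
    have h1 := hLΦ (γ t)
    rw [ht] at h1
    have h2 : L (ℓ t) = Fm p := by
      simp only [ℓ, map_add, map_smul, hLx, smul_zero, add_zero]
      exact hLΦ p
    exact (congrFun (h1.symm.trans h2) ⟨e, he⟩)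
  -- on the curve, the pairs in `I` keep their lengths, hence so does every edge
  have hrows : ∀ᶠ t in nhds (0 : ℝ), rowSpan (γ t) G.edgeSet ≤ rowSpan (γ t) I := by
    have h1 := hp.eventually_rowSpan_le hI hIG hspan.ge
    rw [← hγ0] at h1
    exact (hγc.eventually h1).mono fun t ht => ht.1
  have hderiv : ∀ᶠ t in nhds (0 : ℝ), ∀ e ∈ G.edgeSet,
      HasDerivAt (fun s => halfSqLength (γ s) e) 0 t := by
    filter_upwards [hFγ.eventually_nhds, hrows, hγd] with t h1 h2 h3 e he
    have h4 : rowSpan (γ t) I ≤ LinearMap.ker (motionPairing (deriv γ t)) := by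
      rw [rowSpan_le_iff]
      intro i hi
      have h5 := hasDerivAt_halfSqLength h3.hasDerivAt i
      have h6 : HasDerivAt (fun s => halfSqLength (γ s) i) 0 t :=
        (hasDerivAt_const t (halfSqLength p i)).congr_of_eventuallyEq
          (h1.mono fun s hs => hs i hi)
      exact h5.unique h6
    have h7 := hasDerivAt_halfSqLength h3.hasDerivAt e
    have h8 : motionPairing (deriv γ t) (rigidityRow (γ t) e) = 0 :=
      h4 (h2 (rigidityRow_mem_rowSpan _ he))
    rwa [h8] at h7
  have hconst : ∀ᶠ t in nhds (0 : ℝ), ∀ e ∈ G.edgeSet,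
      halfSqLength (γ t) e = halfSqLength p e := by
    obtain ⟨δ, hδ, hball⟩ := Metric.eventually_nhds_iff_ball.1 hderiv
    filter_upwards [Metric.ball_mem_nhds 0 hδ] with t ht e he
    have h1 := (convex_ball (0 : ℝ) δ).is_const_of_fderivWithin_eq_zero (𝕜 := ℝ)
      (f := fun s => halfSqLength (γ s) e)
      (fun s hs => (hball s hs e he).differentiableAt.differentiableWithinAt)
      (fun s hs => by
        rw [fderivWithin_of_isOpen Metric.isOpen_ball hs]
        have := (hball s hs e he).hasFDerivAt.fderiv
        rw [this]
        ext; simp) ht (Metric.mem_ball_self hδ)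
    simpa [hγ0] using h1
  have hne : ∀ᶠ t in nhdsWithin (0 : ℝ) {0}ᶜ,
      halfSqLength (γ t) s(u, v) ≠ halfSqLength p s(u, v) := by
    have h1 := hasDerivAt_halfSqLength hγd.self_of_nhds.hasDerivAt s(u, v)
    rw [hγ0', hγ0] at h1
    exact h1.eventually_ne hf
  rintro ⟨ε, hε, hrig⟩
  have hclose : ∀ᶠ t in nhds (0 : ℝ), dist (γ t) p < ε := by
    have := hγc.eventually (Metric.ball_mem_nhds (γ 0) hε)
    rw [hγ0] at this
    exact this
  obtain ⟨t, ⟨ht1, ht2⟩, ht3⟩ :=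
    (((hconst.and hclose).filter_mono nhdsWithin_le_nhds).and hne).exists
  have hnorm : ∀ a b, halfSqLength (γ t) s(a, b) = halfSqLength p s(a, b) ↔
      ‖p a - p b‖ = ‖γ t a - γ t b‖ := by
    intro a b
    simp only [halfSqLength, Sym2.lift_mk]
    rw [← sq_eq_sq₀ (norm_nonneg (p a - p b)) (norm_nonneg _)]
    constructor <;> intro h <;> linarith
  refine ht3 ((hnorm u v).2 (hrig (γ t) (fun a b hab => (hnorm a b).1 (ht1 s(a, b) hab)) ?_ u v))
  intro a
  rw [← dist_eq_norm, dist_comm]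
  exact (dist_le_pi_dist (γ t) p a).trans_lt ht2

end Rigidity

/-! ### Ranks of complete graphs and of graphs partitioned into cliques -/

section UpperBound

variable {V : Type u} {d : ℕ}

theorem rowRank_edgesWithin_top_le_choose [Finite V] (p : V → EuclideanSpace ℝ (Fin d))
    (A : Finset V) : rowRank p (edgesWithin ⊤ A) ≤ A.card.choose 2 := by
  classical
  refine (rowRank_le_ncard p _).trans ?_
  rw [← Sym2.card_image_offDiag, ← Set.ncard_coe_finset]
  refine Set.ncard_le_ncard ?_ (Finset.finite_toSet _)
  rintro e ⟨he, heA⟩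
  induction e using Sym2.ind with
  | h a b =>
    rw [Finset.mem_coe, Finset.mem_image]
    refine ⟨(a, b), ?_, rfl⟩
    rw [Finset.mem_offDiag]
    exact ⟨heA a (by simp), heA b (by simp), by simpa using he⟩

theorem IsGeneric.rowRank_edgesWithin_top_le [Finite V] {p : V → EuclideanSpace ℝ (Fin d)}
    (hp : IsGeneric p) (A : Finset V) (hA : d ≤ A.card) :
    rowRank p (edgesWithin ⊤ A) ≤ d.choose 2 + d * (A.card - d) := by
  classical
  obtain ⟨T, hTA, hTc⟩ := Finset.exists_subset_card_eq hA
  set F : Set (Sym2 V) := edgesWithin ⊤ T ∪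
    (((T ×ˢ (A \ T)).image fun x => s(x.1, x.2) : Finset (Sym2 V)) : Set (Sym2 V)) with hF
  have hTT : ∀ s ∈ T, ∀ t ∈ T, s ≠ t → rigidityRow p s(s, t) ∈ rowSpan p F := by
    intro s hs t ht hst
    refine rigidityRow_mem_rowSpan p (Or.inl ⟨by simpa using hst, fun x hx => ?_⟩)
    rcases Sym2.mem_iff.1 hx with rfl | rfl
    · exact hs
    · exact ht
  have haT : ∀ a ∈ A, a ∉ T → ∀ t ∈ T, rigidityRow p s(a, t) ∈ rowSpan p F := by
    intro a ha haT t ht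
    refine rigidityRow_mem_rowSpan p (Or.inr ?_)
    rw [Finset.mem_coe, Finset.mem_image]
    exact ⟨(t, a), by simp [ht, ha, haT], Sym2.eq_swap⟩
  have h1 : rowSpan p (edgesWithin ⊤ A) ≤ rowSpan p F := by
    rw [rowSpan_le_iff]
    rintro e ⟨he, heA⟩
    induction e using Sym2.ind with
    | h a b =>
      have ha := heA a (by simp)
      have hb := heA b (by simp)
      have hab : a ≠ b := by simpa using he
      by_cases h1 : a ∈ T <;> by_cases h2 : b ∈ T
      · exact hTT a h1 b h2 hab
      · rw [Sym2.eq_swap]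
        exact haT b hb h2 a h1
      · exact haT a ha h1 b h2
      · exact hp.rigidityRow_mem_of_card_eq _ hTc h1 h2 hTT (haT a ha h1) (haT b hb h2)
  calc rowRank p (edgesWithin ⊤ A) ≤ rowRank p F := by
        cases nonempty_fintype V
        exact Submodule.finrank_mono h1
    _ ≤ _ := rowRank_union_le p _ _
    _ ≤ d.choose 2 + d * (A.card - d) := by
      refine Nat.add_le_add ?_ ?_
      · have h2 := rowRank_edgesWithin_top_le_choose p T
        rwa [hTc] at h2
      · refine (rowRank_le_ncard p _).trans ?_
        rw [Set.ncard_coe_finset]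
        refine Finset.card_image_le.trans ?_
        rw [Finset.card_product, Finset.card_sdiff_of_subset hTA, hTc]

theorem IsGeneric.le_rowRank_edgesWithin_top [Fintype V] {p : V → EuclideanSpace ℝ (Fin d)}
    (hp : IsGeneric p) (A : Finset V) :
    ∑ i ∈ Finset.range A.card, min i d ≤ rowRank p (edgesWithin ⊤ A) := by
  classical
  induction A using Finset.induction_on with
  | empty => simp
  | insert v A hv ih =>
    rw [Finset.card_insert_of_notMem hv, Finset.sum_range_succ]
    have h1 := rowRank_edgesWithin_erase_add_min_le hp (⊤ : SimpleGraph V)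
      (Finset.mem_insert_self v A)
    rw [Finset.erase_insert hv] at h1
    have h2 : (⊤ : SimpleGraph V).neighborFinset v ∩ insert v A = A := by
      ext x
      simp only [Finset.mem_inter, SimpleGraph.mem_neighborFinset, SimpleGraph.top_adj,
        Finset.mem_insert]
      constructor
      · rintro ⟨h, rfl | h'⟩
        · exact absurd rfl h
        · exact h'
      · exact fun h => ⟨fun hvx => hv (hvx ▸ h), Or.inr h⟩
    rw [h2] at h1
    omega

/-- `m_{d,k} - 1 / 2` is the rank of the complete graph on `k` vertices, per vertex. -/
theorem IsGeneric.rowRank_edgesWithin_top_le_minRankConst [Finite V]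
    {p : V → EuclideanSpace ℝ (Fin d)} (hp : IsGeneric p) {k : ℕ} (hk : 1 ≤ k) {A : Finset V}
    (hA : A.card = k) :
    (rowRank p (edgesWithin ⊤ A) : ℝ) ≤ (minRankConst d k - 1 / 2) * k := by
  have hk0 : (k : ℝ) ≠ 0 := by exact_mod_cast (by omega : k ≠ 0)
  rw [minRankConst]
  split_ifs with hkd
  · have h1 := rowRank_edgesWithin_top_le_choose p A
    rw [hA] at h1
    have h2 : (rowRank p (edgesWithin ⊤ A) : ℝ) ≤ (k.choose 2 : ℝ) := by exact_mod_cast h1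
    rw [Nat.cast_choose_two] at h2
    refine h2.trans (le_of_eq ?_)
    ring
  · have h1 := hp.rowRank_edgesWithin_top_le A (by omega)
    rw [hA] at h1
    have h2 : (rowRank p (edgesWithin ⊤ A) : ℝ) ≤ (d.choose 2 : ℝ) + d * ((k : ℝ) - d) := by
      rw [← Nat.cast_sub (by omega)]
      exact_mod_cast h1
    rw [Nat.cast_choose_two] at h2
    refine h2.trans (le_of_eq ?_)
    field_simp
    ring

theorem rowRank_biUnion_le [Finite V] {C : Type*} (p : V → EuclideanSpace ℝ (Fin d))
    (s : Finset C) (F : C → Set (Sym2 V)) :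
    rowRank p (⋃ c ∈ s, F c) ≤ ∑ c ∈ s, rowRank p (F c) := by
  classical
  induction s using Finset.induction_on with
  | empty => simpa using rowRank_le_ncard p ∅
  | insert c s hc ih =>
    rw [Finset.set_biUnion_insert, Finset.sum_insert hc]
    exact (rowRank_union_le p _ _).trans (Nat.add_le_add le_rfl ih)

theorem two_mul_ncard_edgeSet_le [Fintype V] (H : SimpleGraph V)
    (h : ∀ v x y, H.Adj v x → H.Adj v y → x = y) : 2 * H.edgeSet.ncard ≤ Fintype.card V := by
  classical
  rw [← SimpleGraph.coe_edgeFinset, Set.ncard_coe_finset, ← H.sum_degrees_eq_twice_card_edges]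
  refine (Finset.sum_le_card_nsmul _ _ 1 fun v _ => ?_).trans (by simp)
  rw [← H.card_neighborFinset_eq_degree, Finset.card_le_one]
  intro x hx y hy
  exact h v x y (by simpa using hx) (by simpa using hy)

/-- If the vertices of `G` are partitioned into classes of size `k` such that every vertex has at
most one neighbour outside its class, then the rank of `G` is at most `m_{d,k}` per vertex. -/
theorem IsGeneric.rowRank_le_minRankConst_mul [Fintype V] {p : V → EuclideanSpace ℝ (Fin d)}
    (hp : IsGeneric p) {k : ℕ} (hk : 1 ≤ k) (G : SimpleGraph V) {C : Type*} [Fintype C]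
    [DecidableEq C] (π : V → C) (hπ : ∀ c, (Finset.univ.filter fun v => π v = c).card = k)
    (h : ∀ v x y, G.Adj v x → π v ≠ π x → G.Adj v y → π v ≠ π y → x = y) :
    (rowRank p G.edgeSet : ℝ) ≤ minRankConst d k * Fintype.card V := by
  classical
  let H : SimpleGraph V :=
    { Adj := fun a b => G.Adj a b ∧ π a ≠ π b
      symm := ⟨fun a b hab => ⟨hab.1.symm, hab.2.symm⟩⟩
      loopless := ⟨fun a ha => ha.2 rfl⟩ }
  have hH := two_mul_ncard_edgeSet_le H fun v x y hx hy => h v x y hx.1 hx.2 hy.1 hy.2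
  have hsub : G.edgeSet ⊆ (⋃ c ∈ (Finset.univ : Finset C),
      edgesWithin ⊤ (Finset.univ.filter fun v => π v = c)) ∪ H.edgeSet := by
    intro e he
    induction e using Sym2.ind with
    | h a b =>
      by_cases hab : π a = π b
      · refine Or.inl (Set.mem_biUnion (Finset.mem_univ (π a)) ⟨?_, fun x hx => ?_⟩)
        · have : G.Adj a b := he
          simpa using this.ne
        · rcases Sym2.mem_iff.1 hx with rfl | rfl <;> simp [hab]
      · exact Or.inr ⟨he, hab⟩
  have h1 : rowRank p G.edgeSet ≤ ∑ c : C,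
      rowRank p (edgesWithin ⊤ (Finset.univ.filter fun v => π v = c)) + H.edgeSet.ncard :=
    (rowRank_mono p hsub).trans ((rowRank_union_le p _ _).trans
      (Nat.add_le_add (rowRank_biUnion_le p _ _) (rowRank_le_ncard p _)))
  have h2 : (rowRank p G.edgeSet : ℝ) ≤ ∑ c : C,
      (rowRank p (edgesWithin ⊤ (Finset.univ.filter fun v => π v = c)) : ℝ) +
        H.edgeSet.ncard := by exact_mod_cast h1
  have h3 : ∑ c : C, (rowRank p (edgesWithin ⊤ (Finset.univ.filter fun v => π v = c)) : ℝ) ≤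
      Fintype.card C • ((minRankConst d k - 1 / 2) * k) :=
    Finset.sum_le_card_nsmul _ _ _ fun c _ =>
      hp.rowRank_edgesWithin_top_le_minRankConst hk (hπ c)
  have h4 : Fintype.card V = Fintype.card C * k := by
    rw [← Finset.card_univ, Finset.card_eq_sum_card_fiberwise (f := π) (t := Finset.univ) (by simp),
      Finset.sum_congr rfl fun c _ => hπ c]
    simp
  have h5 : (Fintype.card V : ℝ) = Fintype.card C * k := by exact_mod_cast h4
  have h6 : 2 * (H.edgeSet.ncard : ℝ) ≤ Fintype.card V := by exact_mod_cast hH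
  rw [nsmul_eq_mul] at h3
  have h7 : (Fintype.card C : ℝ) * ((minRankConst d k - 1 / 2) * k) =
      (minRankConst d k - 1 / 2) * Fintype.card V := by
    rw [h5]; ring
  rw [h7] at h3
  linarith

/-- A graph of rank less than the rank of the complete graph is not rigid. -/
theorem not_isRigid_of_rowRank_lt [Fintype V] {p : V → EuclideanSpace ℝ (Fin d)}
    (hp : IsGeneric p) (G : SimpleGraph V) (hn : d < Fintype.card V)
    (h : (rowRank p G.edgeSet : ℝ) < d * Fintype.card V - d * (d + 1) / 2) : ¬ IsRigid d G := by
  intro hrig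
  have hall : rowSpan p (edgesWithin ⊤ Finset.univ) ≤ rowSpan p G.edgeSet := by
    rw [rowSpan_le_iff]
    intro e _
    induction e using Sym2.ind with
    | h a b =>
      by_contra hab
      exact hp.not_frameworkRigid G hab (hrig p hp)
  have h1 : rowRank p (edgesWithin ⊤ Finset.univ) ≤ rowRank p G.edgeSet :=
    Submodule.finrank_mono hall
  have h2 := (hp.le_rowRank_edgesWithin_top Finset.univ).trans h1
  have h3 : (∑ i ∈ Finset.range (Finset.univ : Finset V).card, ((min i d : ℕ) : ℝ)) ≤
    rowRank p G.edgeSet := by exact_mod_cast h2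
  obtain ⟨D, hD⟩ : ∃ D, Fintype.card V = D + 1 := ⟨Fintype.card V - 1, by omega⟩
  rw [Finset.card_univ, hD, sum_range_min d D (by omega)] at h3
  rw [hD] at h
  push_cast at h
  linarith

end UpperBound

/-! ### Highly connected graphs of small rank -/

section Necklace

variable {m k : ℕ}

/-- The perfect matching of the graph `necklace m k`. With `h = k / 2`, the first `h` vertices of
each clique are matched with the next `h` vertices of the following clique; if `k` is odd, the
remaining vertex is matched with its counterpart in the opposite clique. -/
def necklacePartner (m k : ℕ) (x : ZMod (2 * m) × Fin k) : ZMod (2 * m) × Fin k :=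
  if h₁ : (x.2 : ℕ) < k / 2 then (x.1 + 1, ⟨x.2 + k / 2, by omega⟩)
  else if h₂ : (x.2 : ℕ) < 2 * (k / 2) then (x.1 - 1, ⟨x.2 - k / 2, by omega⟩)
  else (x.1 + m, x.2)

theorem natCast_zmod_ne_zero {n j : ℕ} (h0 : 0 < j) (h : j < n) : (j : ZMod n) ≠ 0 := by
  rw [Ne, ZMod.natCast_eq_zero_iff]
  exact Nat.not_dvd_of_pos_of_lt h0 h

theorem natCast_add_self_zmod_two_mul (m : ℕ) : (m : ZMod (2 * m)) + m = 0 := by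
  have : ((2 * m : ℕ) : ZMod (2 * m)) = 0 := ZMod.natCast_self _
  push_cast at this
  rw [← this]
  ring

theorem necklacePartner_necklacePartner (x : ZMod (2 * m) × Fin k) :
    necklacePartner m k (necklacePartner m k x) = x := by
  obtain ⟨i, a, ha⟩ := x
  by_cases h₁ : a < k / 2
  · have h2 : ¬ a + k / 2 < k / 2 := by omega
    have h3 : a + k / 2 < 2 * (k / 2) := by omega
    simp [necklacePartner, h₁, h3]
  · by_cases h₂ : a < 2 * (k / 2)
    · have h3 : a - k / 2 < k / 2 := by omega
      have h4 : a - k / 2 + k / 2 = a := by omega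
      simp [necklacePartner, h₁, h₂, h3, h4]
    · simp [necklacePartner, h₁, h₂, add_assoc, natCast_add_self_zmod_two_mul]

theorem necklacePartner_fst_ne (hm : 1 ≤ m) (x : ZMod (2 * m) × Fin k) :
    (necklacePartner m k x).1 ≠ x.1 := by
  have h1 : (1 : ZMod (2 * m)) ≠ 0 := by
    simpa using natCast_zmod_ne_zero (n := 2 * m) one_pos (by omega)
  have h2 : (m : ZMod (2 * m)) ≠ 0 := natCast_zmod_ne_zero (by omega) (by omega)
  rw [necklacePartner]
  split_ifs
  · simpa using h1
  · simpa [sub_eq_add_neg] using h1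
  · simpa using h2

/-- A cyclic arrangement of `2 m` cliques of size `k` joined by a perfect matching: consecutive
cliques are joined by `⌊k / 2⌋` edges, and opposite cliques by one more edge if `k` is odd. -/
def necklace (m k : ℕ) (hm : 1 ≤ m) : SimpleGraph (ZMod (2 * m) × Fin k) where
  Adj x y := (x.1 = y.1 ∧ x.2 ≠ y.2) ∨ y = necklacePartner m k x
  symm := ⟨fun x y h => by
    rcases h with h | rfl
    · exact Or.inl ⟨h.1.symm, h.2.symm⟩
    · exact Or.inr (necklacePartner_necklacePartner x).symm⟩
  loopless := ⟨fun x h => by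
    rcases h with h | h
    · exact h.2 rfl
    · exact necklacePartner_fst_ne hm x (congrArg Prod.fst h).symm⟩

variable (S : Finset (ZMod (2 * m) × Fin k))

/-- The link between the cliques `i` and `i + 1` is destroyed by the removal of `S`. -/
def IsBrokenLink (i : ZMod (2 * m)) : Prop :=
  ∀ a : Fin k, (a : ℕ) < k / 2 → (i, a) ∈ S ∨ necklacePartner m k (i, a) ∈ S

/-- The vertices of `S` that are ends of edges between the cliques `i` and `i + 1`. -/
def linkCut (i : ZMod (2 * m)) : Finset (ZMod (2 * m) × Fin k) :=
  S.filter fun x => (x.1 = i ∧ (x.2 : ℕ) < k / 2) ∨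
    (x.1 = i + 1 ∧ k / 2 ≤ (x.2 : ℕ) ∧ (x.2 : ℕ) < 2 * (k / 2))

variable {S}

theorem IsBrokenLink.le_card_linkCut {i : ZMod (2 * m)} (h : IsBrokenLink S i) :
    k / 2 ≤ (linkCut S i).card := by
  have h1 := Finset.card_le_card_of_surjOn (s := linkCut S i) (t := Finset.range (k / 2))
    (fun x => if (x.2 : ℕ) < k / 2 then (x.2 : ℕ) else x.2 - k / 2) ?_
  · simpa using h1
  · intro a ha
    have ha' : a < k / 2 := by simpa using ha
    have hak : a < k := by omega
    rcases h ⟨a, hak⟩ ha' with hS | hS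
    · refine ⟨(i, ⟨a, hak⟩), ?_, by simp [ha']⟩
      simp [linkCut, hS, ha']
    · rw [necklacePartner, dif_pos ha'] at hS
      refine ⟨(i + 1, ⟨a + k / 2, by omega⟩), ?_, by simp⟩
      rw [linkCut, Finset.mem_coe, Finset.mem_filter]
      exact ⟨hS, Or.inr ⟨rfl, Nat.le_add_left _ _, by simp only; omega⟩⟩

theorem disjoint_linkCut {i j : ZMod (2 * m)} (hij : i ≠ j) :
    Disjoint (linkCut S i) (linkCut S j) := by
  rw [Finset.disjoint_left]
  intro x hx hy
  simp only [linkCut, Finset.mem_filter] at hx hy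
  rcases hx.2 with h1 | h1 <;> rcases hy.2 with h2 | h2
  · exact hij (h1.1.symm.trans h2.1)
  · omega
  · omega
  · exact hij (add_right_cancel (h1.1.symm.trans h2.1))

/-- If two links are broken by fewer than `k` vertices, then `S` consists of the ends of edges of
these two links, so that all edges between opposite cliques survive. -/
theorem linkCut_union_eq (hS : S.card < k) {i j : ZMod (2 * m)} (hij : i ≠ j)
    (hi : IsBrokenLink S i) (hj : IsBrokenLink S j) :
    linkCut S i ∪ linkCut S j = S ∧ 2 * (k / 2) < k := by
  have h1 : (linkCut S i ∪ linkCut S j).card = _ := Finset.card_union_of_disjoint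
    (disjoint_linkCut hij)
  have h2 := hi.le_card_linkCut
  have h3 := hj.le_card_linkCut
  have hsub : linkCut S i ∪ linkCut S j ⊆ S :=
    Finset.union_subset (Finset.filter_subset _ _) (Finset.filter_subset _ _)
  have h4 := Finset.card_le_card hsub
  exact ⟨Finset.eq_of_subset_of_card_le hsub (by omega), by omega⟩

/-- The surviving vertices of the cliques `i` and `j` are connected after the removal of `S`. -/
def CliquesLinked (hm : 1 ≤ m) (S : Finset (ZMod (2 * m) × Fin k)) (i j : ZMod (2 * m)) : Prop :=
  ∀ (x y : ZMod (2 * m) × Fin k) (hx : x ∉ S) (hy : y ∉ S), x.1 = i → y.1 = j →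
    ((necklace m k hm).induce ((S : Set (ZMod (2 * m) × Fin k))ᶜ)).Reachable ⟨x, hx⟩ ⟨y, hy⟩

theorem exists_fst_eq_notMem (hS : S.card < k) (i : ZMod (2 * m)) : ∃ x ∉ S, x.1 = i := by
  by_contra! h
  have h1 : Finset.univ.image (fun a : Fin k => (i, a)) ⊆ S := by
    intro x hx
    rw [Finset.mem_image] at hx
    obtain ⟨a, -, rfl⟩ := hx
    by_contra hxS
    exact h _ hxS rfl
  have h2 := Finset.card_le_card h1
  rw [Finset.card_image_of_injective _ (fun a b hab => congrArg Prod.snd hab)] at h2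
  simp at h2
  omega

variable (hm : 1 ≤ m)

theorem CliquesLinked.refl (i : ZMod (2 * m)) : CliquesLinked hm S i i := by
  intro x y hx hy h1 h2
  by_cases hxy : x = y
  · subst hxy
    exact SimpleGraph.Reachable.refl _
  · refine SimpleGraph.Adj.reachable ?_
    exact Or.inl ⟨h1.trans h2.symm, fun h => hxy (Prod.ext (h1.trans h2.symm) h)⟩

variable {hm}

theorem CliquesLinked.symm {i j : ZMod (2 * m)} (h : CliquesLinked hm S i j) :
    CliquesLinked hm S j i :=
  fun x y hx hy h1 h2 => (h y x hy hx h2 h1).symm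

theorem CliquesLinked.trans (hS : S.card < k) {i j l : ZMod (2 * m)}
    (h : CliquesLinked hm S i j) (h' : CliquesLinked hm S j l) : CliquesLinked hm S i l := by
  intro x y hx hy h1 h2
  obtain ⟨z, hz, hzj⟩ := exists_fst_eq_notMem hS j
  exact (h x z hx hz h1 hzj).trans (h' z y hz hy hzj h2)

theorem CliquesLinked.of_notMem {x : ZMod (2 * m) × Fin k} (hx : x ∉ S)
    (hx' : necklacePartner m k x ∉ S) : CliquesLinked hm S x.1 (necklacePartner m k x).1 := by
  intro y z hy hz h1 h2
  refine (CliquesLinked.refl hm x.1 y x hy hx h1 rfl).trans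
    (SimpleGraph.Reachable.trans (SimpleGraph.Adj.reachable ?_)
      (CliquesLinked.refl hm _ _ z hx' hz rfl h2))
  exact Or.inr rfl

theorem CliquesLinked.of_not_isBrokenLink {i : ZMod (2 * m)} (h : ¬ IsBrokenLink S i) :
    CliquesLinked hm S i (i + 1) := by
  simp only [IsBrokenLink] at h
  push Not at h
  obtain ⟨a, ha, h1, h2⟩ := h
  have h3 := CliquesLinked.of_notMem (hm := hm) h1 h2
  have h4 : (necklacePartner m k (i, a)).1 = i + 1 := by
    rw [necklacePartner, dif_pos ha]
  rwa [h4] at h3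

theorem CliquesLinked.add_natCast (hS : S.card < k) (i : ZMod (2 * m)) (t : ℕ)
    (h : ∀ j < t, CliquesLinked hm S (i + j) (i + j + 1)) : CliquesLinked hm S i (i + t) := by
  induction t with
  | zero => simpa using CliquesLinked.refl hm i
  | succ t ih =>
    have h1 := (ih fun j hj => h j (by omega)).trans hS (h t (by omega))
    rw [add_assoc] at h1
    exact_mod_cast h1

/-- Consecutive cliques stay connected when fewer than `k` vertices are removed. If the link between
them is broken, then they are connected the other way round, or through opposite cliques if another
link is broken as well. -/
theorem CliquesLinked.succ (hk : 2 ≤ k) (hS : S.card < k) (i : ZMod (2 * m)) :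
    CliquesLinked hm S i (i + 1) := by
  by_cases hi : IsBrokenLink S i
  swap
  · exact CliquesLinked.of_not_isBrokenLink hi
  by_cases hf : ∃ f, f ≠ i ∧ IsBrokenLink S f
  · obtain ⟨f, hfi, hf⟩ := hf
    obtain ⟨hunion, hodd⟩ := linkCut_union_eq hS hfi.symm hi hf
    have hgood : ∀ g, g ≠ i → g ≠ f → CliquesLinked hm S g (g + 1) := by
      intro g hgi hgf
      refine CliquesLinked.of_not_isBrokenLink fun hg => ?_
      have h1 := hg.le_card_linkCut
      have h2 : (linkCut S g).Nonempty := Finset.card_pos.1 (by omega)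
      obtain ⟨x, hx⟩ := h2
      have hxS : x ∈ S := (Finset.mem_filter.1 hx).1
      rw [← hunion, Finset.mem_union] at hxS
      rcases hxS with h | h
      · exact Finset.disjoint_left.1 (disjoint_linkCut hgi) hx h
      · exact Finset.disjoint_left.1 (disjoint_linkCut hgf) hx h
    have hopp : ∀ g, CliquesLinked hm S g (g + m) := by
      intro g
      have hlast : ∀ g, ((g, ⟨2 * (k / 2), hodd⟩) : ZMod (2 * m) × Fin k) ∉ S := by
        intro g hg
        rw [← hunion, Finset.mem_union] at hg
        simp only [linkCut, Finset.mem_filter] at hg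
        omega
      have h1 : necklacePartner m k (g, ⟨2 * (k / 2), hodd⟩) = (g + m, ⟨2 * (k / 2), hodd⟩) := by
        rw [necklacePartner, dif_neg (by simp; omega), dif_neg (by simp)]
      have h2 := CliquesLinked.of_notMem (hm := hm) (hlast g) (by rw [h1]; exact hlast _)
      rwa [h1] at h2
    by_cases hfm : f = i + m
    · subst hfm
      have h1 : CliquesLinked hm S (i + 1) (i + 1 + (m - 1 : ℕ)) := by
        refine CliquesLinked.add_natCast hS _ _ fun j hj => hgood _ ?_ ?_
        · intro h
          refine natCast_zmod_ne_zero (n := 2 * m) (j := 1 + j) (by omega) (by omega) ?_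
          push_cast
          have : i + (1 + (j : ZMod (2 * m))) = i + 0 := by rw [← add_assoc, h, add_zero]
          exact add_left_cancel this
        · intro h
          refine natCast_zmod_ne_zero (n := 2 * m) (j := m - (1 + j)) (by omega) (by omega) ?_
          rw [Nat.cast_sub (by omega), sub_eq_zero]
          push_cast
          have : i + (1 + (j : ZMod (2 * m))) = i + m := by rw [← add_assoc, h]
          exact (add_left_cancel this).symm
      have h2 : i + 1 + ((m - 1 : ℕ) : ZMod (2 * m)) = i + m := by
        rw [Nat.cast_sub hm]
        push_cast
        ring
      rw [h2] at h1
      exact (h1.trans hS (hopp i).symm).symm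
    · have hne : i + (m : ZMod (2 * m)) ≠ i := by
        intro h
        exact natCast_zmod_ne_zero (n := 2 * m) (j := m) (by omega) (by omega) (by simpa using h)
      have h1 := hgood (i + m) hne fun h => hfm h.symm
      have h2 : i + m + 1 = i + 1 + (m : ZMod (2 * m)) := by ring
      rw [h2] at h1
      exact (hopp i).trans hS (h1.trans hS (hopp (i + 1)).symm)
  · push Not at hf
    have h1 : CliquesLinked hm S (i + 1) (i + 1 + (2 * m - 1 : ℕ)) := by
      refine CliquesLinked.add_natCast hS _ _ fun j hj =>
        CliquesLinked.of_not_isBrokenLink (hf _ fun h => ?_)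
      refine natCast_zmod_ne_zero (n := 2 * m) (j := 1 + j) (by omega) (by omega) ?_
      push_cast
      have : i + (1 + (j : ZMod (2 * m))) = i + 0 := by rw [← add_assoc, h, add_zero]
      exact add_left_cancel this
    have h2 : i + 1 + ((2 * m - 1 : ℕ) : ZMod (2 * m)) = i := by
      rw [Nat.cast_sub (by omega), ZMod.natCast_self]
      push_cast
      ring
    rw [h2] at h1
    exact h1.symm

theorem isKConnected_necklace (hm : 1 ≤ m) (hk : 2 ≤ k) : IsKConnected k (necklace m k hm) := by
  have : NeZero (2 * m) := ⟨by omega⟩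
  refine ⟨?_, fun S hS => ?_⟩
  · rw [Nat.card_eq_fintype_card, Fintype.card_prod, ZMod.card, Fintype.card_fin]
    nlinarith
  · have hall : ∀ i : ZMod (2 * m), CliquesLinked hm S 0 i := by
      intro i
      have h1 := CliquesLinked.add_natCast (hm := hm) hS 0 i.val fun j _ =>
        CliquesLinked.succ hk hS _
      rwa [ZMod.natCast_zmod_val, zero_add] at h1
    obtain ⟨x, hx, -⟩ := exists_fst_eq_notMem hS (0 : ZMod (2 * m))
    rw [SimpleGraph.connected_iff]
    refine ⟨fun ⟨y, hy⟩ ⟨z, hz⟩ => ?_, ⟨⟨x, hx⟩⟩⟩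
    exact ((hall y.1).symm.trans hS (hall z.1)) y z hy hz rfl rfl

theorem IsKConnected.comap_equiv {V W : Type*} {G : SimpleGraph W} (h : IsKConnected k G)
    (e : V ≃ W) : IsKConnected k (G.comap e) := by
  classical
  refine ⟨by rw [Nat.card_congr e]; exact h.1, fun S hS => ?_⟩
  have h1 := h.2 (S.map e.toEmbedding) (by rwa [Finset.card_map])
  let φ : (G.comap e).induce ((S : Set V)ᶜ) ≃g
      G.induce (((S.map e.toEmbedding : Finset W) : Set W)ᶜ) :=
    { toEquiv := e.subtypeEquiv fun a => by simp
      map_rel_iff' := Iff.rfl }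
  exact φ.connected_iff.2 h1

end Necklace

/-! ### Connectivity and the two bounds -/

section Main

theorem IsKConnected.hasNoSmallSeparation {V : Type u} [Fintype V] [DecidableEq V] {k : ℕ}
    {G : SimpleGraph V} (h : IsKConnected k G) : HasNoSmallSeparation k G Finset.univ := by
  intro X _ Y _ ⟨x, hx⟩ ⟨y, hy⟩ hXY hadj
  by_contra hlt
  have hconn := h.2 (Finset.univ \ (X ∪ Y)) (by omega)
  have hX : ∀ z ∈ X, z ∈ ((Finset.univ \ (X ∪ Y) : Finset V) : Set V)ᶜ := by
    intro z hz
    simp [hz]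
  have hY : ∀ z ∈ Y, z ∈ ((Finset.univ \ (X ∪ Y) : Finset V) : Set V)ᶜ := by
    intro z hz
    simp [hz]
  obtain ⟨w⟩ := hconn.preconnected ⟨x, hX x hx⟩ ⟨y, hY y hy⟩
  obtain ⟨e, -, h1, h2⟩ := w.exists_boundary_dart {z | (z : V) ∈ X} hx
    (Finset.disjoint_right.1 hXY hy)
  have h3 : (e.snd : V) ∈ X ∨ (e.snd : V) ∈ Y := by
    have := e.snd.2
    simpa [or_iff_not_imp_left] using this
  rcases h3 with h3 | h3
  · exact h2 h3
  · exact hadj _ h1 _ h3 e.adj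

/-- The closure of `G` in the rigidity matroid of the complete graph on its vertices. -/
def rigidityClosure {V : Type u} {d : ℕ} (p : V → EuclideanSpace ℝ (Fin d)) (G : SimpleGraph V) :
    SimpleGraph V where
  Adj u w := u ≠ w ∧ rigidityRow p s(u, w) ∈ rowSpan p G.edgeSet
  symm := ⟨fun u w h => ⟨h.1.symm, by rw [Sym2.eq_swap]; exact h.2⟩⟩
  loopless := ⟨fun _ h => h.1 rfl⟩

theorem rowSpan_rigidityClosure {V : Type u} {d : ℕ} (p : V → EuclideanSpace ℝ (Fin d))
    (G : SimpleGraph V) : rowSpan p (rigidityClosure p G).edgeSet = rowSpan p G.edgeSet := by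
  refine le_antisymm (rowSpan_le_iff.2 fun e he => ?_) (rowSpan_mono p fun e he => ?_)
  · induction e using Sym2.ind with
    | h a b => exact he.2
  · induction e using Sym2.ind with
    | h a b => exact ⟨SimpleGraph.Adj.ne he, rigidityRow_mem_rowSpan p he⟩

/-- The lower bound on the rank of non-rigid `k`-connected graphs. -/
theorem minRankConst_mul_card_le_rigidityRank {V : Type u} [Fintype V] {d k : ℕ} (hd : 1 ≤ d)
    (hkd : k < d * (d + 1)) (G : SimpleGraph V) (hG : IsKConnected k G) (hrig : ¬ IsRigid d G) :
    minRankConst d k * (Fintype.card V : ℝ) ≤ (rigidityRank d G : ℝ) := by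
  classical
  rw [IsRigid] at hrig
  push Not at hrig
  obtain ⟨p, hp, hpG⟩ := hrig
  rw [rigidityRank_eq_rowRank G hp]
  have hsep := hG.hasNoSmallSeparation
  rw [minRankConst]
  split_ifs with hk
  · exact half_mul_card_le_rowRank hp hk hsep (by simpa using hG.1)
  · have hcl : IsClosedIn p (rigidityClosure p G) := by
      intro u w huw h
      rw [rowSpan_rigidityClosure] at h
      exact ⟨huw, h⟩
    have h1 := hcl.mul_card_le_rowRank hp hd (by omega) hkd Finset.univ ?_ ?_
    · rw [edgesWithin_univ, Finset.card_univ, rowRank, rowSpan_rigidityClosure] at h1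
      exact h1
    · intro X hX Y hY hXn hYn hXY hadj
      refine hsep X hX Y hY hXn hYn hXY fun x hx y hy hxy => hadj x hx y hy ?_
      exact ⟨hxy.ne, rigidityRow_mem_rowSpan p hxy⟩
    · intro hcomplete
      refine hpG (hp.frameworkRigid G fun u v huv => ?_)
      exact (hcomplete (by simp) (by simp) huv).2

theorem minRankConst_lt {d k : ℕ} (hd : 1 ≤ d) (hk : 1 ≤ k) (hkd : k < d * (d + 1)) :
    minRankConst d k < d := by
  have hd' : (1 : ℝ) ≤ d := by exact_mod_cast hd
  have hk0 : (0 : ℝ) < k := by exact_mod_cast hk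
  rw [minRankConst]
  split_ifs with h
  · have : (k : ℝ) ≤ d := by exact_mod_cast h
    linarith
  · have h1 : (1 : ℝ) < (d : ℝ) * (d + 1) / k := by
      rw [lt_div_iff₀ hk0, one_mul]
      exact_mod_cast hkd
    linarith

/-- The necklaces attain the lower bound. -/
theorem exists_isKConnected_rigidityRank_eq {d k : ℕ} (hd : 1 ≤ d) (hk : 2 ≤ k)
    (hkd : k < d * (d + 1)) (N : ℕ) : ∃ n : ℕ, N ≤ n ∧ ∃ G : SimpleGraph (Fin n),
      IsKConnected k G ∧ ¬ IsRigid d G ∧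
        (rigidityRank d G : ℝ) = minRankConst d k * (n : ℝ) := by
  have hlt := minRankConst_lt hd (by omega) hkd
  -- for large `n` the rank `m_{d,k} n` is less than that of the complete graph
  obtain ⟨M, hM⟩ := exists_nat_gt ((d : ℝ) * (d + 1) / 2 / (d - minRankConst d k))
  set m := N + M + d + 1 with hm
  have hm1 : 1 ≤ m := by omega
  have : NeZero (2 * m) := ⟨by omega⟩
  have hcard : Fintype.card (ZMod (2 * m) × Fin k) = 2 * m * k := by
    rw [Fintype.card_prod, ZMod.card, Fintype.card_fin]
  have hmn : m ≤ 2 * m * k := by nlinarith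
  let e : Fin (2 * m * k) ≃ ZMod (2 * m) × Fin k := (Fintype.equivFinOfCardEq hcard).symm
  let G : SimpleGraph (Fin (2 * m * k)) := (necklace m k hm1).comap e
  have hconn : IsKConnected k G := (isKConnected_necklace hm1 hk).comap_equiv e
  have hp := isGeneric_genericRealisation (Fin (2 * m * k)) d
  have hupper : (rowRank (genericRealisation (Fin (2 * m * k)) d) G.edgeSet : ℝ) ≤
      minRankConst d k * (2 * m * k : ℕ) := by
    have h1 := hp.rowRank_le_minRankConst_mul (k := k) (by omega) G (fun v => (e v).1) ?_ ?_
    · rwa [Fintype.card_fin] at h1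
    · intro i
      have hinj : Function.Injective fun a : Fin k => e.symm (i, a) :=
        fun a b hab => congrArg Prod.snd (e.symm.injective hab)
      have h2 : (Finset.univ.filter fun v => (e v).1 = i) =
          (Finset.univ : Finset (Fin k)).image fun a => e.symm (i, a) := by
        ext v
        simp only [Finset.mem_filter, Finset.mem_univ, true_and, Finset.mem_image]
        constructor
        · rintro rfl
          exact ⟨(e v).2, by simp⟩
        · rintro ⟨a, rfl⟩
          simp
      rw [h2, Finset.card_image_of_injective _ hinj, Finset.card_univ, Fintype.card_fin]
    · intro v x y hx hvx hy hvy
      have key : ∀ z, G.Adj v z → (e v).1 ≠ (e z).1 → e z = necklacePartner m k (e v) := by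
        intro z hz hvz
        rcases hz with hz | hz
        · exact absurd hz.1 hvz
        · exact hz
      exact e.injective ((key x hx hvx).trans (key y hy hvy).symm)
  have hnr : ¬ IsRigid d G := by
    refine not_isRigid_of_rowRank_lt hp G (by rw [Fintype.card_fin]; omega) ?_
    rw [Fintype.card_fin]
    refine hupper.trans_lt ?_
    have h1 : (M : ℝ) ≤ (2 * m * k : ℕ) := by exact_mod_cast (by omega : M ≤ 2 * m * k)
    have hpos : 0 < (d : ℝ) - minRankConst d k := by linarith
    have h2 := (div_lt_iff₀ hpos).1 (hM.trans_le h1)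
    linarith
  refine ⟨2 * m * k, by omega, G, hconn, hnr, le_antisymm ?_ ?_⟩
  · rw [rigidityRank_eq_rowRank G hp]
    exact hupper
  · have h1 := minRankConst_mul_card_le_rigidityRank hd hkd G hconn hnr
    rwa [Fintype.card_fin] at h1

end Main

end GraphRigidity

theorem mainTheorem4 (d k : ℕ) (hk : 1 ≤ k) (hkd : k < d * (d + 1)) :
    (∀ (V : Type*) [Fintype V] (G : SimpleGraph V),
      GraphRigidity.IsKConnected k G → ¬ GraphRigidity.IsRigid d G →
        GraphRigidity.minRankConst d k * (Fintype.card V : ℝ) ≤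
          (GraphRigidity.rigidityRank d G : ℝ)) ∧
    (2 ≤ k → ∀ N : ℕ, ∃ n : ℕ, N ≤ n ∧ ∃ G : SimpleGraph (Fin n),
      GraphRigidity.IsKConnected k G ∧ ¬ GraphRigidity.IsRigid d G ∧
        (GraphRigidity.rigidityRank d G : ℝ) =
          GraphRigidity.minRankConst d k * (n : ℝ)) := by
  have hd : 1 ≤ d := by
    rcases Nat.eq_zero_or_pos d with rfl | h
    · simp at hkd
    · exact h
  exact ⟨fun V _ G hG hrig =>
      GraphRigidity.minRankConst_mul_card_le_rigidityRank hd hkd G hG hrig,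
    fun h2 N => GraphRigidity.exists_isKConnected_rigidityRank_eq hd h2 hkd N⟩
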